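/- Let $G$ be a finite group and $H\subseteq G$ a subgroup. The Burnside category $\mathscr B_G$ has the finite $G$-sets as objects; morphisms $T\to U$ are the group completion of the monoid (under disjoint union) of isomorphism classes of spans $T\leftarrow S\to U$ of finite $G$-sets, composed by pullback. A Mackey functor is an additive functor $M:\mathscr B_G\to Ab$; a $G$-map $f:X\to Y$ induces the restriction $f^*:M(Y)\to M(X)$ (span $Y\leftarrow X= X$) and the transfer $f_*:M(X)\to M(Y)$ (span $X=X\to Y$). Restricting $M$ along the maps $f^*$ between orbits gives its underlying coefficient system, a functor $\mathscr O_G^{op}\to Ab$ on the orbit category. Let $\underline{\mathbb Z}$ be the constant Green functor (value $\mathbb Z$ at every orbit $G/K$, restrictions along maps of orbits equal to the identity; on a finite $G$-set $T$ it is the ring of $G$-invariant functions $T\to\mathbb Z$, with transfers given by summation over fibres). A $\underline{\mathbb Z}$-module is a Mackey functor $M$ with a unital and associative action $M\,\Box\,\underline{\mathbb Z}\to M$, i.e. homomorphisms $M(S)\otimes\underline{\mathbb Z}(T)\to M(S\times T)$ natural in $S,T\in\mathscr B_G$; morphisms of $\underline{\mathbb Z}$-modules are the morphisms of Mackey functors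 compatible with the actions. For an abelian group $A$ let $\Xi_{G/H}(A)$ be the $\underline{\mathbb Z}$-module $$T\longmapsto A\otimes \mathrm{Map}_G(T,\mathbb Z(G/H)),$$ where a span $T\xleftarrow{p}S\xrightarrow{q}U$ acts by $\mathrm{id}_A$ tensored with $\varphi\mapsto\bigl(u\mapsto\sum_{q(s)=u}\varphi(p(s))\bigr)$, and $\underline{\mathbb Z}$ acts by external multiplication $(a\otimes\varphi)\cdot\psi=a\otimes\bigl((s,t)\mapsto\psi(t)\varphi(s)\bigr)$; this is a functor of $A$. Then: 1. Evaluation at the coset $K$ gives, for every subgroup $K\subseteq G$, an isomorphism, natural in $A$, $$\Xi_{G/H}(A)(G/K)\cong A\otimes(\mathbb Z(G/H))^K .$$ For $K\subseteq L$ and the projection $G/K\to G/L$, the restriction is $\mathrm{id}_A$ tensored with the inclusion $(\mathbb Z(G/H))^L\subseteq(\mathbb Z(G/H))^K$, and the transfer is $\mathrm{id}_A$ tensored with the sum over coset representatives $v\mapsto\sum_{\gamma\in L/K}\gamma v$. For a general $G$-map $G/K\to G/L$, $K\mapsto gL$, the restriction is induced by $v\mapsto gv$. 2. $\Xi_{G/H}(A)$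 is the universal $\underline{\mathbb Z}$-module on the coefficient system $A\otimes F_{G/H}: G/K\mapsto A\otimes\mathbb Z\,\mathrm{Map}_G(G/K,G/H)$: for every $\underline{\mathbb Z}$-module $M$, every morphism of coefficient systems $A\otimes F_{G/H}\to M$ factors through the canonical morphism $\eta_A:A\otimes F_{G/H}\to\Xi_{G/H}(A)$, $a\otimes f\mapsto a\otimes f$ (that is, $a\otimes f(K)\in A\otimes(\mathbb Z(G/H))^K$), by a unique morphism of $\underline{\mathbb Z}$-modules $\Xi_{G/H}(A)\to M$. 3. $\Xi_{G/H}:Ab\to\underline{\mathbb Z}\text{-Mod}$ is left adjoint to the evaluation functor $M\mapsto M(G/H)$, with unit $A\to\Xi_{G/H}(A)(G/H)$, $a\mapsto\eta_A(a\otimes\mathrm{id}_{G/H})$. -/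

import Mathlib

open CategoryTheory TensorProduct

universe u v

namespace MackeyTheory

section Burnside

/-- A finite `G`-set. -/
structure FinGSet (G : Type u) [Group G] : Type (u + 1) where
  carrier : Type u
  [action : MulAction G carrier]
  [finite : Finite carrier]

namespace FinGSet

variable {G : Type u} [Group G]

instance : CoeSort (FinGSet G) (Type u) := ⟨carrier⟩

attribute [instance] FinGSet.action FinGSet.finite

noncomputable instance (X : FinGSet G) : Fintype X := Fintype.ofFinite X

/-- The product of two finite `G`-sets, with the diagonal action. -/
abbrev prod (X Y : FinGSet G) : FinGSet G := ⟨X × Y⟩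

/-- The one-point `G`-set `G/G`. -/
abbrev pt (G : Type u) [Group G] : FinGSet G := ⟨PUnit⟩

instance : MulAction G PEmpty.{u + 1} where
  smul _ x := x
  one_smul _ := rfl
  mul_smul _ _ _ := rfl

/-- The empty `G`-set. -/
abbrev empty (G : Type u) [Group G] : FinGSet G := ⟨PEmpty⟩

/-- The disjoint union of two finite `G`-sets. -/
abbrev sum (X Y : FinGSet G) : FinGSet G := ⟨X ⊕ Y⟩

/-- The set-theoretic pullback of two `G`-maps with the same target. -/
@[ext]
structure Pb {X Y Z : FinGSet G} (f : X →[G] Z) (k : Y →[G] Z) : Type u where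
  fst : X
  snd : Y
  eq : f fst = k snd

namespace Pb

variable {X Y Z : FinGSet G} (f : X →[G] Z) (k : Y →[G] Z)

instance : MulAction G (Pb f k) where
  smul g p := ⟨g • p.fst, g • p.snd, by rw [map_smul, map_smul, p.eq]⟩
  one_smul p := Pb.ext (one_smul G _) (one_smul G _)
  mul_smul g h p := Pb.ext (mul_smul g h _) (mul_smul g h _)

@[simp] lemma smul_fst (g : G) (p : Pb f k) : (g • p).fst = g • p.fst := rfl
@[simp] lemma smul_snd (g : G) (p : Pb f k) : (g • p).snd = g • p.snd := rfl

instance : Finite (Pb f k) :=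
  Finite.of_injective (fun p => (p.fst, p.snd)) fun _ _ h =>
    Pb.ext (congrArg Prod.fst h) (congrArg Prod.snd h)

end Pb

/-- The pullback of two `G`-maps with the same target, as a finite `G`-set. -/
abbrev pullback {X Y Z : FinGSet G} (f : X →[G] Z) (k : Y →[G] Z) : FinGSet G := ⟨Pb f k⟩

/-- The orbit `G/K`. -/
abbrev orbit [Finite G] (K : Subgroup G) : FinGSet G := ⟨G ⧸ K⟩

end FinGSet

open FinGSet

variable {G : Type u} [Group G]

/-- A span `T ← S → U` of finite `G`-sets. -/
structure GSpan (T U : FinGSet G) where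
  apex : FinGSet G
  left : apex →[G] T
  right : apex →[G] U

namespace GSpan

variable {T U V W : FinGSet G}

/-- Two spans are isomorphic if there is a `G`-equivariant bijection of their apices that is
compatible with both legs. -/
def Isom (s t : GSpan T U) : Prop :=
  ∃ e : s.apex →[G] t.apex, Function.Bijective e ∧
    (∀ x, t.left (e x) = s.left x) ∧ ∀ x, t.right (e x) = s.right x

lemma Isom.refl (s : GSpan T U) : s.Isom s :=
  ⟨MulActionHom.id G, Function.bijective_id, fun _ => rfl, fun _ => rfl⟩

lemma Isom.symm {s t : GSpan T U} (h : s.Isom t) : t.Isom s := by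
  obtain ⟨e, he, hl, hr⟩ := h
  obtain ⟨i, h1, h2⟩ := Function.bijective_iff_has_inverse.1 he
  refine ⟨⟨i, fun g x => he.1 ?_⟩, Function.bijective_iff_has_inverse.2 ⟨e, h2, h1⟩,
    fun x => ?_, fun x => ?_⟩
  · simp [h2 _]
  · rw [← hl]; exact congrArg _ (h2 x)
  · rw [← hr]; exact congrArg _ (h2 x)

lemma Isom.trans {s t r : GSpan T U} (h : s.Isom t) (h' : t.Isom r) : s.Isom r := by
  obtain ⟨e, he, hl, hr⟩ := h
  obtain ⟨e', he', hl', hr'⟩ := h'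
  exact ⟨e'.comp e, he'.comp he, fun x => (hl' _).trans (hl x), fun x => (hr' _).trans (hr x)⟩

instance setoid (T U : FinGSet G) : Setoid (GSpan T U) :=
  ⟨Isom, Isom.refl, Isom.symm, Isom.trans⟩

/-- The span `T ← ∅ → U`. -/
abbrev zero (T U : FinGSet G) : GSpan T U :=
  ⟨FinGSet.empty G, ⟨fun x => x.elim, fun _ x => x.elim⟩, ⟨fun x => x.elim, fun _ x => x.elim⟩⟩

/-- The coproduct of two spans in the apex coordinate. -/
abbrev add (s t : GSpan T U) : GSpan T U :=
  ⟨s.apex.sum t.apex,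
    ⟨Sum.elim s.left t.left, by rintro g (x | x) <;> simp⟩,
    ⟨Sum.elim s.right t.right, by rintro g (x | x) <;> simp⟩⟩

/-- The identity span. -/
abbrev id (T : FinGSet G) : GSpan T T := ⟨T, MulActionHom.id G, MulActionHom.id G⟩

/-- Composition of spans by pullback. -/
abbrev comp (s : GSpan T U) (t : GSpan U V) : GSpan T V :=
  ⟨pullback s.right t.left,
    ⟨fun p => s.left p.fst, fun g p => by simp⟩,
    ⟨fun p => t.right p.snd, fun g p => by simp⟩⟩

/-- The product of two spans. -/
abbrev prod {T' U' : FinGSet G} (s : GSpan T U) (t : GSpan T' U') :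
    GSpan (T.prod T') (U.prod U') :=
  ⟨s.apex.prod t.apex,
    ⟨fun p => (s.left p.1, t.left p.2), fun g p => by ext <;> simp⟩,
    ⟨fun p => (s.right p.1, t.right p.2), fun g p => by ext <;> simp⟩⟩

lemma add_congr {s s' t t' : GSpan T U} (h : s.Isom s') (h' : t.Isom t') :
    (s.add t).Isom (s'.add t') := by
  obtain ⟨e, he, hl, hr⟩ := h
  obtain ⟨e', he', hl', hr'⟩ := h'
  refine ⟨⟨Sum.map e e', ?_⟩, ?_, ?_, ?_⟩
  · rintro g (x | x) <;> simp
  · exact Sum.map_bijective.2 ⟨he, he'⟩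
  · rintro (x | x)
    · exact hl x
    · exact hl' x
  · rintro (x | x)
    · exact hr x
    · exact hr' x

lemma comp_congr {s s' : GSpan T U} {t t' : GSpan U V} (h : s.Isom s') (h' : t.Isom t') :
    (s.comp t).Isom (s'.comp t') := by
  obtain ⟨e, he, hl, hr⟩ := h
  obtain ⟨e', he', hl', hr'⟩ := h'
  refine ⟨⟨fun p => ⟨e p.fst, e' p.snd, by rw [hr, hl', p.eq]⟩, ?_⟩, ⟨?_, ?_⟩, ?_, ?_⟩
  · intro g p
    ext <;> simp
  · intro p q hh
    exact Pb.ext (he.1 (congrArg Pb.fst hh)) (he'.1 (congrArg Pb.snd hh))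
  · rintro ⟨a, b, h⟩
    obtain ⟨a, rfl⟩ := he.2 a
    obtain ⟨b, rfl⟩ := he'.2 b
    refine ⟨⟨a, b, ?_⟩, rfl⟩
    rw [← hr, ← hl']
    exact h
  · intro p; exact hl _
  · intro p; exact hr' _

lemma prod_congr {T' U' : FinGSet G} {s s' : GSpan T U} {t t' : GSpan T' U'}
    (h : s.Isom s') (h' : t.Isom t') : (s.prod t).Isom (s'.prod t') := by
  obtain ⟨e, he, hl, hr⟩ := h
  obtain ⟨e', he', hl', hr'⟩ := h'
  refine ⟨⟨Prod.map e e', fun g p => by ext <;> simp⟩, he.prodMap he', ?_, ?_⟩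
  · intro p; exact Prod.ext (hl _) (hl' _)
  · intro p; exact Prod.ext (hr _) (hr' _)

lemma zero_add_isom (s : GSpan T U) : ((zero T U).add s).Isom s := by
  refine ⟨⟨Sum.elim PEmpty.elim (fun x => x), ?_⟩, ⟨?_, ?_⟩, ?_, ?_⟩
  · rintro g (x | x)
    · exact x.elim
    · rfl
  · rintro (x | x) (y | y) h
    · exact x.elim
    · exact x.elim
    · exact y.elim
    · exact congrArg _ h
  · intro x; exact ⟨Sum.inr x, rfl⟩
  · rintro (x | x)
    · exact x.elim
    · rfl
  · rintro (x | x)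
    · exact x.elim
    · rfl

lemma add_comm_isom (s t : GSpan T U) : (s.add t).Isom (t.add s) := by
  refine ⟨⟨Sum.swap, ?_⟩, (Equiv.sumComm _ _).bijective, ?_, ?_⟩
  · rintro g (x | x) <;> rfl
  · rintro (x | x) <;> rfl
  · rintro (x | x) <;> rfl

lemma add_assoc_isom (s t r : GSpan T U) : ((s.add t).add r).Isom (s.add (t.add r)) := by
  refine ⟨⟨Equiv.sumAssoc _ _ _, ?_⟩, (Equiv.sumAssoc _ _ _).bijective, ?_, ?_⟩
  · rintro g ((x | x) | x) <;> rfl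
  · rintro ((x | x) | x) <;> rfl
  · rintro ((x | x) | x) <;> rfl

lemma id_comp_isom (s : GSpan T U) : ((id T).comp s).Isom s := by
  refine ⟨⟨Pb.snd, fun g p => rfl⟩, ⟨?_, ?_⟩, ?_, fun p => rfl⟩
  · rintro ⟨a, b, h⟩ ⟨a', b', h'⟩ (rfl : b = b')
    exact Pb.ext (Eq.trans h h'.symm) rfl
  · intro x; exact ⟨⟨s.left x, x, rfl⟩, rfl⟩
  · intro p; exact p.eq.symm

lemma comp_id_isom (s : GSpan T U) : (s.comp (id U)).Isom s := by
  refine ⟨⟨Pb.fst, fun g p => rfl⟩, ⟨?_, ?_⟩, fun p => rfl, ?_⟩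
  · rintro ⟨a, b, h⟩ ⟨a', b', h'⟩ (rfl : a = a')
    exact Pb.ext rfl (Eq.trans h.symm h')
  · intro x; exact ⟨⟨x, s.right x, rfl⟩, rfl⟩
  · intro p; exact p.eq

lemma comp_assoc_isom (s : GSpan T U) (t : GSpan U V) (r : GSpan V W) :
    ((s.comp t).comp r).Isom (s.comp (t.comp r)) := by
  refine ⟨⟨fun p => ⟨p.fst.fst, ⟨p.fst.snd, p.snd, p.eq⟩, p.fst.eq⟩, fun g p => rfl⟩,
    ⟨?_, ?_⟩, fun p => rfl, fun p => rfl⟩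
  · rintro ⟨⟨a, b, h1⟩, c, h2⟩ ⟨⟨a', b', h1'⟩, c', h2'⟩ hh
    have e1 : a = a' := congrArg (fun p => p.fst) hh
    have e2 : b = b' := congrArg (fun p => p.snd.fst) hh
    have e3 : c = c' := congrArg (fun p => p.snd.snd) hh
    subst e1 e2 e3; rfl
  · rintro ⟨a, ⟨b, c, h1⟩, h2⟩
    exact ⟨⟨⟨a, b, h2⟩, c, h1⟩, rfl⟩

lemma zero_comp_isom (t : GSpan U V) : ((zero T U).comp t).Isom (zero T V) :=
  ⟨⟨Pb.fst, fun _ p => p.fst.elim⟩, ⟨fun p => p.fst.elim, fun x => x.elim⟩,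
    fun p => p.fst.elim, fun p => p.fst.elim⟩

lemma comp_zero_isom (s : GSpan T U) : (s.comp (zero U V)).Isom (zero T V) :=
  ⟨⟨Pb.snd, fun _ p => p.snd.elim⟩, ⟨fun p => p.snd.elim, fun x => x.elim⟩,
    fun p => p.snd.elim, fun p => p.snd.elim⟩

lemma add_comp_isom (s s' : GSpan T U) (t : GSpan U V) :
    ((s.add s').comp t).Isom ((s.comp t).add (s'.comp t)) := by
  refine Isom.symm ⟨⟨Sum.elim (fun p => ⟨Sum.inl p.fst, p.snd, p.eq⟩)
    (fun p => ⟨Sum.inr p.fst, p.snd, p.eq⟩), ?_⟩, ⟨?_, ?_⟩, ?_, ?_⟩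
  · rintro g (p | p) <;> rfl
  · rintro (p | p) (q | q) hh
    all_goals
      have e1 := congrArg Pb.fst hh
      have e2 := congrArg Pb.snd hh
    · exact congrArg _ (Pb.ext (Sum.inl_injective e1) e2)
    · cases e1
    · cases e1
    · exact congrArg _ (Pb.ext (Sum.inr_injective e1) e2)
  · rintro ⟨a | a, b, h⟩
    · exact ⟨Sum.inl ⟨a, b, h⟩, rfl⟩
    · exact ⟨Sum.inr ⟨a, b, h⟩, rfl⟩
  · rintro (p | p) <;> rfl
  · rintro (p | p) <;> rfl

lemma comp_add_isom (s : GSpan T U) (t t' : GSpan U V) :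
    (s.comp (t.add t')).Isom ((s.comp t).add (s.comp t')) := by
  refine Isom.symm ⟨⟨Sum.elim (fun p => ⟨p.fst, Sum.inl p.snd, p.eq⟩)
    (fun p => ⟨p.fst, Sum.inr p.snd, p.eq⟩), ?_⟩, ⟨?_, ?_⟩, ?_, ?_⟩
  · rintro g (p | p) <;> rfl
  · rintro (p | p) (q | q) hh
    all_goals
      have e1 := congrArg Pb.fst hh
      have e2 := congrArg Pb.snd hh
    · exact congrArg _ (Pb.ext e1 (Sum.inl_injective e2))
    · cases e2
    · cases e2
    · exact congrArg _ (Pb.ext e1 (Sum.inr_injective e2))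
  · rintro ⟨a, b | b, h⟩
    · exact ⟨Sum.inl ⟨a, b, h⟩, rfl⟩
    · exact ⟨Sum.inr ⟨a, b, h⟩, rfl⟩
  · rintro (p | p) <;> rfl
  · rintro (p | p) <;> rfl

section

variable {T' U' : FinGSet G}

lemma zero_prod_isom (t : GSpan T' U') : ((zero T U).prod t).Isom (zero _ _) :=
  ⟨⟨fun p => p.1, fun _ p => p.1.elim⟩, ⟨fun p => p.1.elim, fun x => x.elim⟩,
    fun p => p.1.elim, fun p => p.1.elim⟩

lemma prod_zero_isom (s : GSpan T U) : (s.prod (zero T' U')).Isom (zero _ _) :=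
  ⟨⟨fun p => p.2, fun _ p => p.2.elim⟩, ⟨fun p => p.2.elim, fun x => x.elim⟩,
    fun p => p.2.elim, fun p => p.2.elim⟩

lemma add_prod_isom (s s' : GSpan T U) (t : GSpan T' U') :
    ((s.add s').prod t).Isom ((s.prod t).add (s'.prod t)) := by
  refine ⟨⟨Equiv.sumProdDistrib _ _ _, ?_⟩, (Equiv.sumProdDistrib _ _ _).bijective, ?_, ?_⟩
  · rintro g ⟨x | x, y⟩ <;> rfl
  · rintro ⟨x | x, y⟩ <;> rfl
  · rintro ⟨x | x, y⟩ <;> rfl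

lemma prod_add_isom (s : GSpan T U) (t t' : GSpan T' U') :
    (s.prod (t.add t')).Isom ((s.prod t).add (s.prod t')) := by
  refine ⟨⟨Equiv.prodSumDistrib _ _ _, ?_⟩, (Equiv.prodSumDistrib _ _ _).bijective, ?_, ?_⟩
  · rintro g ⟨y, x | x⟩ <;> rfl
  · rintro ⟨y, x | x⟩ <;> rfl
  · rintro ⟨y, x | x⟩ <;> rfl

end

end GSpan

/-- Isomorphism classes of spans. -/
def SpanClass (T U : FinGSet G) : Type (u + 1) := Quotient (GSpan.setoid T U)

namespace SpanClass

variable {T U V : FinGSet G}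

def mk (s : GSpan T U) : SpanClass T U := Quotient.mk _ s

lemma sound {s t : GSpan T U} (h : s.Isom t) : mk s = mk t := Quotient.sound h

lemma ind {p : SpanClass T U → Prop} (h : ∀ s, p (mk s)) (x : SpanClass T U) : p x :=
  Quotient.ind h x

instance : Add (SpanClass T U) :=
  ⟨Quotient.map₂ GSpan.add fun _ _ h _ _ h' => GSpan.add_congr h h'⟩

instance : Zero (SpanClass T U) := ⟨mk (GSpan.zero T U)⟩

lemma mk_add (s t : GSpan T U) : mk (s.add t) = mk s + mk t := rfl
lemma mk_zero : mk (GSpan.zero T U) = 0 := rfl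

/-- Isomorphism classes of spans form a commutative monoid under coproduct. -/
instance : AddCommMonoid (SpanClass T U) where
  nsmul := nsmulRec
  add_assoc a b c := by
    induction a using ind; induction b using ind; induction c using ind
    exact sound (GSpan.add_assoc_isom _ _ _)
  zero_add a := by
    induction a using ind
    exact sound (GSpan.zero_add_isom _)
  add_zero a := by
    induction a using ind
    exact sound ((GSpan.add_comm_isom _ _).trans (GSpan.zero_add_isom _))
  add_comm a b := by
    induction a using ind; induction b using ind
    exact sound (GSpan.add_comm_isom _ _)

/-- Composition of isomorphism classes of spans, as a biadditive map. -/
def comp (T U V : FinGSet G) : SpanClass T U →+ SpanClass U V →+ SpanClass T V where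
  toFun x :=
    { toFun := Quotient.map₂ GSpan.comp (fun _ _ h _ _ h' => GSpan.comp_congr h h') x
      map_zero' := by
        induction x using ind
        exact sound (GSpan.comp_zero_isom _)
      map_add' := fun y z => by
        induction x using ind; induction y using ind; induction z using ind
        exact sound (GSpan.comp_add_isom _ _ _) }
  map_zero' := by
    ext x
    induction x using ind
    exact sound (GSpan.zero_comp_isom _)
  map_add' x y := by
    ext z
    induction x using ind; induction y using ind; induction z using ind
    exact sound (GSpan.add_comp_isom _ _ _)

/-- The product of isomorphism classes of spans, as a biadditive map. -/
def prod (T U T' U' : FinGSet G) :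
    SpanClass T U →+ SpanClass T' U' →+ SpanClass (T.prod T') (U.prod U') where
  toFun x :=
    { toFun := Quotient.map₂ GSpan.prod (fun _ _ h _ _ h' => GSpan.prod_congr h h') x
      map_zero' := by
        induction x using ind
        exact sound (GSpan.prod_zero_isom _)
      map_add' := fun y z => by
        induction x using ind; induction y using ind; induction z using ind
        exact sound (GSpan.prod_add_isom _ _ _) }
  map_zero' := by
    ext x
    induction x using ind
    exact sound (GSpan.zero_prod_isom _)
  map_add' x y := by
    ext z
    induction x using ind; induction y using ind; induction z using ind
    exact sound (GSpan.add_prod_isom _ _ _)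

end SpanClass

section Completion

open Algebra

variable {M N P : Type*} [AddCommMonoid M] [AddCommMonoid N] [AddCommMonoid P]

lemma completion_ind {p : GrothendieckAddGroup M → Prop}
    (of : ∀ m, p (GrothendieckAddGroup.of m)) (sub : ∀ x y, p x → p y → p (x - y)) (x) : p x := by
  induction x using AddLocalization.ind with
  | H y =>
    have : AddLocalization.mk y.1 y.2 =
        GrothendieckAddGroup.of y.1 - GrothendieckAddGroup.of (y.2 : M) := by
      simp [GrothendieckAddGroup.of, ← AddLocalization.mk_zero_eq_addMonoidOf_mk]
    rw [this]
    exact sub _ _ (of _) (of _)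

lemma lift_of {A : Type*} [AddCommGroup A] (f : M →+ A) (m : M) :
    GrothendieckAddGroup.lift f (GrothendieckAddGroup.of m) = f m :=
  DFunLike.congr_fun (GrothendieckAddGroup.lift.symm_apply_apply f) m

/-- The biadditive extension of a biadditive map to group completions. -/
noncomputable def bilift (b : M →+ N →+ P) :
    GrothendieckAddGroup M →+ GrothendieckAddGroup N →+ GrothendieckAddGroup P :=
  GrothendieckAddGroup.lift
    { toFun := fun m => GrothendieckAddGroup.lift (GrothendieckAddGroup.of.comp (b m))
      map_zero' := by
        refine GrothendieckAddGroup.lift.symm.injective ?_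
        ext n
        simp
      map_add' := fun x y => by
        refine GrothendieckAddGroup.lift.symm.injective ?_
        ext n
        change GrothendieckAddGroup.lift (GrothendieckAddGroup.of.comp (b (x + y))) (GrothendieckAddGroup.of n) =
          GrothendieckAddGroup.lift (GrothendieckAddGroup.of.comp (b x)) (GrothendieckAddGroup.of n) +
            GrothendieckAddGroup.lift (GrothendieckAddGroup.of.comp (b y)) (GrothendieckAddGroup.of n)
        simp only [lift_of, AddMonoidHom.comp_apply, map_add, AddMonoidHom.add_apply] }

lemma bilift_of_of (b : M →+ N →+ P) (m : M) (n : N) :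
    bilift b (GrothendieckAddGroup.of m) (GrothendieckAddGroup.of n) =
      GrothendieckAddGroup.of (b m n) := by
  rw [bilift, lift_of]
  exact lift_of _ _

end Completion

open Algebra

/-- The Burnside category of `G`. Its objects are the finite `G`-sets. -/
abbrev Burnside (G : Type u) [Group G] : Type (u + 1) := FinGSet G

namespace Burnside

/-- The morphisms `T ⟶ U`: the group completion of the isomorphism classes of spans. -/
abbrev Hom (T U : FinGSet G) : Type (u + 1) := GrothendieckAddGroup (SpanClass T U)

/-- The morphism given by a span. -/
noncomputable def ofSpan {T U : FinGSet G} (s : GSpan T U) : Hom T U :=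
  GrothendieckAddGroup.of (SpanClass.mk s)

lemma ofSpan_sound {T U : FinGSet G} {s t : GSpan T U} (h : s.Isom t) : ofSpan s = ofSpan t :=
  congrArg GrothendieckAddGroup.of (SpanClass.sound h)

lemma hom_ind {T U : FinGSet G} {p : Hom T U → Prop}
    (of : ∀ s, p (ofSpan s)) (sub : ∀ x y, p x → p y → p (x - y)) (x) : p x :=
  completion_ind (fun m => by induction m using SpanClass.ind; exact of _) sub x

/-- Composition, extended biadditively from spans. -/
noncomputable def compHom (T U V : FinGSet G) : Hom T U →+ Hom U V →+ Hom T V :=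
  bilift (SpanClass.comp T U V)

lemma compHom_ofSpan {T U V : FinGSet G} (s : GSpan T U) (t : GSpan U V) :
    compHom T U V (ofSpan s) (ofSpan t) = ofSpan (s.comp t) :=
  bilift_of_of _ _ _

/-- The Cartesian product on morphisms, extended biadditively from spans. -/
noncomputable def prodHom (T U T' U' : FinGSet G) :
    Hom T U →+ Hom T' U' →+ Hom (T.prod T') (U.prod U') :=
  bilift (SpanClass.prod T U T' U')

lemma prodHom_ofSpan {T U T' U' : FinGSet G} (s : GSpan T U) (t : GSpan T' U') :
    prodHom T U T' U' (ofSpan s) (ofSpan t) = ofSpan (s.prod t) :=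
  bilift_of_of _ _ _

noncomputable instance : Category.{u + 1} (Burnside G) where
  Hom T U := Hom T U
  id T := ofSpan (GSpan.id T)
  comp f g := compHom _ _ _ f g
  id_comp f := by
    induction f using hom_ind with
    | of s => rw [compHom_ofSpan]; exact ofSpan_sound s.id_comp_isom
    | sub x y hx hy => rw [map_sub, hx, hy]
  comp_id f := by
    induction f using hom_ind with
    | of s => rw [compHom_ofSpan]; exact ofSpan_sound s.comp_id_isom
    | sub x y hx hy => rw [map_sub, AddMonoidHom.sub_apply, hx, hy]
  assoc f g h := by
    induction f using hom_ind with
    | sub x y hx hy => simp only [map_sub, AddMonoidHom.sub_apply, hx, hy]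
    | of s =>
      induction g using hom_ind with
      | sub x y hx hy => simp only [map_sub, AddMonoidHom.sub_apply, hx, hy]
      | of t =>
        induction h using hom_ind with
        | sub x y hx hy => simp only [map_sub, hx, hy]
        | of r =>
          simp only [compHom_ofSpan]
          exact ofSpan_sound (s.comp_assoc_isom t r)

lemma compHom_add_left {T U V : FinGSet G} (f f' : Hom T U) (k : Hom U V) :
    compHom T U V (f + f') k = compHom T U V f k + compHom T U V f' k := by
  rw [map_add, AddMonoidHom.add_apply]

lemma compHom_add_right {T U V : FinGSet G} (f : Hom T U) (k k' : Hom U V) :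
    compHom T U V f (k + k') = compHom T U V f k + compHom T U V f k' :=
  map_add _ _ _

noncomputable instance : Preadditive (Burnside G) where
  homGroup T U := Algebra.GrothendieckAddGroup.instAddCommGroup (M := SpanClass T U)
  add_comp _ _ _ f f' k := compHom_add_left f f' k
  comp_add _ _ _ f k k' := compHom_add_right f k k'

/-- The morphism `Y ⟶ X` given by the span `Y ← X = X`; it induces restriction along `f`. -/
noncomputable def res {X Y : FinGSet G} (f : X →[G] Y) : (Y : Burnside G) ⟶ X :=
  ofSpan ⟨X, f, MulActionHom.id G⟩

/-- The morphism `X ⟶ Y` given by the span `X = X → Y`; it induces transfer along `f`. -/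
noncomputable def tr {X Y : FinGSet G} (f : X →[G] Y) : (X : Burnside G) ⟶ Y :=
  ofSpan ⟨X, MulActionHom.id G, f⟩

/-- The Cartesian product of two morphisms of the Burnside category. -/
noncomputable def prodMap {S S' T T' : FinGSet G} (f : (S : Burnside G) ⟶ S')
    (k : (T : Burnside G) ⟶ T') : (S.prod T : Burnside G) ⟶ S'.prod T' :=
  prodHom S S' T T' f k

lemma res_id (X : FinGSet G) : res (MulActionHom.id G : X →[G] X) = 𝟙 (X : Burnside G) := rfl

lemma res_comp {X Y Z : FinGSet G} (f : X →[G] Y) (k : Y →[G] Z) :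
    res (k.comp f) = res k ≫ res f := by
  refine Eq.symm ((compHom_ofSpan _ _).trans (ofSpan_sound ?_))
  refine ⟨⟨Pb.snd, fun g p => rfl⟩, ⟨?_, ?_⟩, ?_, fun p => rfl⟩
  · rintro ⟨a, b, h⟩ ⟨a', b', h'⟩ (rfl : b = b')
    exact Pb.ext (Eq.trans h h'.symm) rfl
  · intro x; exact ⟨⟨f x, x, rfl⟩, rfl⟩
  · intro p; exact congrArg k p.eq.symm

end Burnside

/-- The isomorphism `(S × T) × U → S × (T × U)` of `G`-sets. -/
def assocMap (S T U : FinGSet G) : (S.prod T).prod U →[G] S.prod (T.prod U) :=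
  ⟨fun p => (p.1.1, p.1.2, p.2), fun _ _ => rfl⟩

/-- The isomorphism `S → S × G/G` of `G`-sets. -/
def rightUnitMap (S : FinGSet G) : S →[G] S.prod (pt G) := ⟨fun x => (x, ⟨⟩), fun _ _ => rfl⟩

/-- The isomorphism `S → G/G × S` of `G`-sets. -/
def leftUnitMap (S : FinGSet G) : S →[G] (pt G).prod S := ⟨fun x => (⟨⟩, x), fun _ _ => rfl⟩

/-- The isomorphism `S × T → T × S` of `G`-sets. -/
def swapMap (S T : FinGSet G) : S.prod T →[G] T.prod S := ⟨Prod.swap, fun _ _ => rfl⟩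

end Burnside

open FinGSet Burnside

section Mackey

/-- A Mackey functor is an additive functor from the Burnside category to abelian groups. -/
abbrev Mackey (G : Type u) [Group G] := Burnside G ⥤+ AddCommGrpCat.{u}

variable {G : Type u} [Group G]

namespace Mackey

/-- The value of a Mackey functor at a finite `G`-set. -/
abbrev val (M : Mackey G) (T : FinGSet G) : AddCommGrpCat.{u} := M.obj.obj T

/-- The homomorphism induced by a morphism of the Burnside category. -/
abbrev ind (M : Mackey G) {T U : FinGSet G} (f : (T : Burnside G) ⟶ U) : M.val T →+ M.val U :=
  (M.obj.map f).hom

/-- The component of a morphism of Mackey functors. -/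
abbrev comp {M N : Mackey G} (α : M ⟶ N) (T : FinGSet G) : M.val T →+ N.val T :=
  (α.hom.app T).hom

end Mackey

/-- A Green functor: a commutative monoid for the box product. A map `M □ N ⟶ P` out of the box
product, i.e. out of the left Kan extension of `(S, T) ↦ M(S) ⊗ N(T)` along the Cartesian product
of the Burnside category, is a family of homomorphisms `M(S) ⊗ N(T) → P(S × T)` that is natural
with respect to all morphisms of the Burnside category in both variables. A map from the unit of
the box product (the Burnside Green functor, which is represented by `G/G`) to `P` is an element
of `P(G/G)`. -/
structure GreenFunctor (G : Type u) [Group G] where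
  mackey : Mackey G
  mul (S T : FinGSet G) : mackey.val S →+ mackey.val T →+ mackey.val (S.prod T)
  mul_natural {S S' T T' : FinGSet G} (f : (S : Burnside G) ⟶ S') (k : (T : Burnside G) ⟶ T')
    (x : mackey.val S) (y : mackey.val T) :
    mul S' T' (mackey.ind f x) (mackey.ind k y) = mackey.ind (prodMap f k) (mul S T x y)
  one : mackey.val (pt G)
  mul_one (S : FinGSet G) (x : mackey.val S) :
    mul S (pt G) x one = mackey.ind (tr (rightUnitMap S)) x
  one_mul (S : FinGSet G) (x : mackey.val S) :
    mul (pt G) S one x = mackey.ind (tr (leftUnitMap S)) x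
  mul_assoc (S T U : FinGSet G) (x : mackey.val S) (y : mackey.val T) (z : mackey.val U) :
    mackey.ind (tr (assocMap S T U)) (mul (S.prod T) U (mul S T x y) z) =
      mul S (T.prod U) x (mul T U y z)
  mul_comm (S T : FinGSet G) (x : mackey.val S) (y : mackey.val T) :
    mackey.ind (tr (swapMap S T)) (mul S T x y) = mul T S y x

/-- A (Mackey functor) module `M` over a Green functor `R`: a unital and associative action
`M □ R ⟶ M`. -/
structure GreenModule (R : GreenFunctor G) where
  mackey : Mackey G
  act (S T : FinGSet G) : mackey.val S →+ R.mackey.val T →+ mackey.val (S.prod T)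
  act_natural {S S' T T' : FinGSet G} (f : (S : Burnside G) ⟶ S') (k : (T : Burnside G) ⟶ T')
    (m : mackey.val S) (r : R.mackey.val T) :
    act S' T' (mackey.ind f m) (R.mackey.ind k r) = mackey.ind (prodMap f k) (act S T m r)
  act_one (S : FinGSet G) (m : mackey.val S) :
    act S (pt G) m R.one = mackey.ind (tr (rightUnitMap S)) m
  act_assoc (S T U : FinGSet G) (m : mackey.val S) (r : R.mackey.val T) (r' : R.mackey.val U) :
    mackey.ind (tr (assocMap S T U)) (act (S.prod T) U (act S T m r) r') =
      act S (T.prod U) m (R.mul T U r r')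

namespace GreenModule

variable {R : GreenFunctor G}

/-- A morphism of `R`-modules: a morphism of Mackey functors that is compatible with the
actions. -/
@[ext]
structure Hom (M N : GreenModule R) where
  hom : M.mackey ⟶ N.mackey
  map_act (S T : FinGSet G) (m : M.mackey.val S) (r : R.mackey.val T) :
    Mackey.comp hom (S.prod T) (M.act S T m r) = N.act S T (Mackey.comp hom S m) r

noncomputable instance : Category (GreenModule R) where
  Hom := Hom
  id M := ⟨𝟙 M.mackey, fun _ _ _ _ => rfl⟩
  comp f g := ⟨f.hom ≫ g.hom, fun S T m r =>
    (congrArg (Mackey.comp g.hom (S.prod T)) (f.map_act S T m r)).trans (g.map_act S T _ r)⟩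

/-- The functor that forgets the action. -/
noncomputable def forget (R : GreenFunctor G) : GreenModule R ⥤ Mackey G where
  obj M := M.mackey
  map f := f.hom

/-- Evaluation of `R`-modules at a finite `G`-set. -/
noncomputable def evaluation (R : GreenFunctor G) (T : FinGSet G) : GreenModule R ⥤ AddCommGrpCat.{u} where
  obj M := M.mackey.val T
  map f := f.hom.hom.app T

end GreenModule

end Mackey

section FixedPoints

open Classical

/-- An additive map, regarded as a `ℤ`-linear map. -/
def toLin {A B : Type*} [AddCommGroup A] [AddCommGroup B] [Module ℤ A] [Module ℤ B]
    (f : A →+ B) : A →ₗ[ℤ] B where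
  toFun := f
  map_add' := f.map_add
  map_smul' n a := by simpa using map_intCast_smul f ℤ ℤ n a

variable {G : Type u} [Group G] {V : Type v} [AddCommGroup V] [Module ℤ V]

/-- The group of `G`-maps from a finite `G`-set `T` to a `ℤ[G]`-module `V`. For `T = G/K` it is
identified with the group of fixed points `V^K` by evaluation at the coset `K`. -/
def equivMaps (ρ : Representation ℤ G V) (T : FinGSet G) : Submodule ℤ (T → V) where
  carrier := {φ | ∀ (g : G) (x : T), φ (g • x) = ρ g (φ x)}
  zero_mem' g x := by simp
  add_mem' ha hb g x := by simp [ha g x, hb g x]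
  smul_mem' n a ha g x := by simp [ha g x]

variable (ρ : Representation ℤ G V) {S T U W : FinGSet G}

lemma sum_zsmul_sum {α β A : Type*} [AddCommGroup A] (s : Finset α) (t : Finset β) (f : α → ℤ)
    (k : β → A) : (∑ x ∈ s, f x) • ∑ y ∈ t, k y = ∑ p ∈ t ×ˢ s, f p.2 • k p.1 := by
  rw [Finset.sum_smul, Finset.sum_product_right]
  simp only [Finset.smul_sum]

lemma sum_fintype_irrel {α A : Type*} [AddCommMonoid A] (i j : Fintype α) (f : α → A) :
    @Finset.sum α A _ (@Finset.univ α i) f = @Finset.sum α A _ (@Finset.univ α j) f := by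
  rw [Subsingleton.elim i j]

/-- The map `(q_* p^* φ)(u) = ∑_{q x = u} φ(p x)` induced by a span `T ←p- X -q→ U`. -/
noncomputable def spanMap (s : GSpan T U) : equivMaps ρ T →ₗ[ℤ] equivMaps ρ U := toLin <|
  AddMonoidHom.mk' (fun φ => ⟨fun u => ∑ x : s.apex, if s.right x = u then φ.1 (s.left x) else 0, by
    intro g u
    rw [map_sum]
    refine (Fintype.sum_equiv (MulAction.toPerm g) _ _ fun x => ?_).symm
    have h := φ.2 g (s.left x)
    simp only [MulAction.toPerm_apply, map_smul, smul_left_cancel_iff]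
    split_ifs
    · exact h.symm
    · simp⟩) fun φ ψ => by
    ext u
    refine Eq.trans (Finset.sum_congr rfl fun x _ => ?_) Finset.sum_add_distrib
    split_ifs
    · rfl
    · exact (add_zero 0).symm

lemma spanMap_apply (s : GSpan T U) (φ : equivMaps ρ T) (u : U) :
    (spanMap ρ s φ).1 u = ∑ x : s.apex, if s.right x = u then φ.1 (s.left x) else 0 := rfl

lemma spanMap_isom {s t : GSpan T U} (h : s.Isom t) : spanMap ρ s = spanMap ρ t := by
  obtain ⟨e, he, hl, hr⟩ := h
  ext φ u
  rw [spanMap_apply, spanMap_apply]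
  exact Fintype.sum_bijective e he _ _ fun x => by rw [hl, hr]

lemma spanMap_id : spanMap ρ (GSpan.id T) = LinearMap.id := by
  ext φ u
  rw [spanMap_apply]
  exact (Finset.sum_ite_eq' Finset.univ u φ.1).trans (if_pos (Finset.mem_univ _))

lemma spanMap_comp (s : GSpan T U) (t : GSpan U W) :
    spanMap ρ (s.comp t) = spanMap ρ t ∘ₗ spanMap ρ s := by
  ext φ w
  rw [spanMap_apply, LinearMap.comp_apply, spanMap_apply]
  simp only [spanMap_apply]
  have h1 : ∀ y : t.apex, (if t.right y = w then
      ∑ x : s.apex, if s.right x = t.left y then φ.1 (s.left x) else 0 else 0) =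
      ∑ x : s.apex, if s.right x = t.left y ∧ t.right y = w then φ.1 (s.left x) else 0 := by
    intro y
    split_ifs with h <;> simp [h]
  rw [Finset.sum_congr rfl fun y _ => h1 y, Finset.sum_comm, ← Finset.sum_product']
  rw [← Finset.sum_filter, ← Finset.sum_filter]
  refine Finset.sum_bij (fun p _ => (p.fst, p.snd)) ?_ ?_ ?_ ?_
  · intro p hp
    simp only [Finset.mem_filter, Finset.mem_univ, true_and] at hp
    simp only [Finset.mem_filter, Finset.mem_product, Finset.mem_univ, true_and]
    exact ⟨p.eq, hp⟩
  · intro p _ q _ h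
    exact Pb.ext (congrArg Prod.fst h) (congrArg Prod.snd h)
  · rintro ⟨x, y⟩ h
    simp only [Finset.mem_filter, Finset.mem_product, Finset.mem_univ, true_and] at h
    exact ⟨⟨x, y, h.1⟩, Finset.mem_filter.2 ⟨@Finset.mem_univ _ (_) _, h.2⟩, rfl⟩
  · intro p _; rfl

lemma spanMap_add (s t : GSpan T U) : spanMap ρ (s.add t) = spanMap ρ s + spanMap ρ t := by
  ext φ u
  rw [spanMap_apply, LinearMap.add_apply]
  exact (sum_fintype_irrel _ (instFintypeSum s.apex t.apex) _).trans (Fintype.sum_sum_type _)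

lemma spanMap_zero : spanMap ρ (GSpan.zero T U) = 0 := by
  ext φ u
  rw [spanMap_apply]
  exact Finset.sum_eq_zero fun x _ => x.elim

/-- The map on `G`-maps induced by a morphism of the Burnside category. -/
noncomputable def burnMap (T U : FinGSet G) :
    Burnside.Hom T U →+ (equivMaps ρ T →ₗ[ℤ] equivMaps ρ U) :=
  Algebra.GrothendieckAddGroup.lift
    { toFun := Quotient.lift (spanMap ρ) fun _ _ h => spanMap_isom ρ h
      map_zero' := spanMap_zero ρ
      map_add' := fun x y => by
        induction x using SpanClass.ind; induction y using SpanClass.ind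
        exact spanMap_add ρ _ _ }

lemma burnMap_ofSpan (s : GSpan T U) : burnMap ρ T U (ofSpan s) = spanMap ρ s :=
  lift_of _ _

lemma burnMap_add (f k : (T : Burnside G) ⟶ U) :
    burnMap ρ T U (f + k) = burnMap ρ T U f + burnMap ρ T U k :=
  map_add (burnMap ρ T U) (f : Burnside.Hom T U) k

lemma burnMap_comp (f : (T : Burnside G) ⟶ U) (k : (U : Burnside G) ⟶ W) :
    burnMap ρ T W (f ≫ k) = burnMap ρ U W k ∘ₗ burnMap ρ T U f := by
  change burnMap ρ T W (compHom T U W f k) = _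
  induction f using hom_ind with
  | sub x y hx hy =>
    simp only [map_sub, AddMonoidHom.sub_apply, hx, hy, LinearMap.comp_sub]
  | of s =>
    induction k using hom_ind with
    | sub x y hx hy => simp only [map_sub, hx, hy, LinearMap.sub_comp]
    | of t => rw [compHom_ofSpan]; simp only [burnMap_ofSpan, spanMap_comp]

lemma burnMap_id : burnMap ρ T T (𝟙 (T : Burnside G)) = LinearMap.id :=
  (burnMap_ofSpan ρ _).trans (spanMap_id ρ)

/-- The transfer along an injective `G`-map takes `φ` to its extension by zero. -/
lemma burnMap_tr_apply (e : T →[G] U) (he : Function.Injective e) (φ : equivMaps ρ T) (x : T) :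
    (burnMap ρ T U (tr e) φ).1 (e x) = φ.1 x := by
  rw [tr, burnMap_ofSpan, spanMap_apply]
  refine Eq.trans (Finset.sum_congr rfl fun y _ => ?_)
    ((Finset.sum_ite_eq' Finset.univ x φ.1).trans (if_pos (Finset.mem_univ _)))
  exact if_congr he.eq_iff rfl rfl

lemma burnMap_res_apply (f : T →[G] U) (φ : equivMaps ρ U) (x : T) :
    (burnMap ρ U T (res f) φ).1 x = φ.1 (f x) := by
  rw [res, burnMap_ofSpan, spanMap_apply]
  exact (Finset.sum_ite_eq' Finset.univ x fun y => φ.1 (f y)).trans (if_pos (Finset.mem_univ _))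

/-- The external product `(φ · ψ)(s, t) = ψ(t) φ(s)` of a `G`-map `φ : S → V` and a `G`-invariant
function `ψ : T → ℤ`. -/
def extMul (S T : FinGSet G) :
    equivMaps (Representation.trivial ℤ G ℤ) T →+
      (equivMaps ρ S →ₗ[ℤ] equivMaps ρ (S.prod T)) where
  toFun ψ := toLin <| AddMonoidHom.mk' (fun φ => ⟨fun p => ψ.1 p.2 • φ.1 p.1, fun g p => by
    have h1 := φ.2 g p.1
    have h2 := ψ.2 g p.2
    rw [Representation.trivial_apply] at h2
    simp only [Prod.smul_fst, Prod.smul_snd, h1, h2, map_zsmul]⟩)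
    fun _ _ => Subtype.ext (funext fun _ => zsmul_add _ _ _)
  map_zero' := LinearMap.ext fun _ => Subtype.ext (funext fun _ => zero_zsmul _)
  map_add' _ _ := LinearMap.ext fun _ => Subtype.ext (funext fun _ => add_zsmul _ _ _)

lemma extMul_apply (φ : equivMaps ρ S) (ψ : equivMaps (Representation.trivial ℤ G ℤ) T)
    (p : S.prod T) : (extMul ρ S T ψ φ).1 p = ψ.1 p.2 • φ.1 p.1 := rfl

lemma extMul_natural {S S' T T' : FinGSet G} (f : (S : Burnside G) ⟶ S')
    (k : (T : Burnside G) ⟶ T') (φ : equivMaps ρ S)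
    (ψ : equivMaps (Representation.trivial ℤ G ℤ) T) :
    extMul ρ S' T' (burnMap (Representation.trivial ℤ G ℤ) T T' k ψ) (burnMap ρ S S' f φ) =
      burnMap ρ (S.prod T) (S'.prod T') (prodMap f k) (extMul ρ S T ψ φ) := by
  change _ = burnMap ρ (S.prod T) (S'.prod T') (prodHom S S' T T' f k) (extMul ρ S T ψ φ)
  induction f using hom_ind with
  | sub x y hx hy => simp only [map_sub, AddMonoidHom.sub_apply, LinearMap.sub_apply, hx, hy]
  | of s =>
    induction k using hom_ind with
    | sub x y hx hy => simp only [map_sub, LinearMap.sub_apply, hx, hy]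
    | of t =>
      rw [prodHom_ofSpan]
      rw [burnMap_ofSpan, burnMap_ofSpan, burnMap_ofSpan ρ (s.prod t)]
      ext ⟨u, w⟩
      rw [extMul_apply, spanMap_apply, spanMap_apply, spanMap_apply]
      rw [sum_zsmul_sum]
      refine (Finset.sum_congr rfl fun p _ => ?_).trans
        (sum_fintype_irrel (instFintypeProd s.apex t.apex) _ _)
      obtain ⟨x, y⟩ := p
      have h : (s.prod t).right (x, y) = ((u, w) : S'.prod T') ↔ s.right x = u ∧ t.right y = w :=
        Prod.mk_inj
      by_cases h1 : s.right x = u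
      · by_cases h2 : t.right y = w
        · rw [if_pos (h.2 ⟨h1, h2⟩), if_pos h1, if_pos h2]; rfl
        · rw [if_neg fun h' => h2 (h.1 h').2, if_neg h2, zero_zsmul]
      · rw [if_neg fun h' => h1 (h.1 h').1, if_neg h1, zsmul_zero]

end FixedPoints

section ConstantGreenFunctor

variable (G : Type u) [Group G]

/-- The functor `T ↦ Map_G(T, ℤ)`, where `G` acts trivially on `ℤ`. -/
noncomputable abbrev constFunctor : Burnside G ⥤ AddCommGrpCat.{u} where
  obj T := AddCommGrpCat.of (equivMaps (Representation.trivial ℤ G ℤ) T)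
  map {T U} f := AddCommGrpCat.ofHom (burnMap (Representation.trivial ℤ G ℤ) T U f).toAddMonoidHom
  map_id T := by rw [burnMap_id]; rfl
  map_comp f k := by rw [burnMap_comp]; rfl

instance : (constFunctor G).Additive where
  map_add {T U f k} := by
    refine AddCommGrpCat.hom_ext (AddMonoidHom.ext fun φ => ?_)
    exact congrArg (fun l => l φ) (burnMap_add (Representation.trivial ℤ G ℤ) f k)

/-- The external product of `G`-invariant functions, `(φ · ψ)(s, t) = φ(s) ψ(t)`. -/
def constMul (S T : FinGSet G) :
    equivMaps (Representation.trivial ℤ G ℤ) S →+ equivMaps (Representation.trivial ℤ G ℤ) T →+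
      equivMaps (Representation.trivial ℤ G ℤ) (S.prod T) :=
  AddMonoidHom.mk'
    (fun φ => AddMonoidHom.mk' (fun ψ => extMul (Representation.trivial ℤ G ℤ) S T ψ φ)
      fun ψ ψ' => by rw [map_add, LinearMap.add_apply])
    fun φ φ' => AddMonoidHom.ext fun ψ =>
      map_add (extMul (Representation.trivial ℤ G ℤ) S T ψ) φ φ'

/-- The constant Green functor `ℤ`: its value at a finite `G`-set `T` is the ring of `G`-invariant
functions `T → ℤ` (so `ℤ` if `T = G/K`), restriction along a `G`-map is composition with it,
and transfer is summation over its fibres. -/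
noncomputable def constZ : GreenFunctor G where
  mackey := AdditiveFunctor.of (constFunctor G)
  mul S T := constMul G S T
  mul_natural f k x y := extMul_natural _ f k x y
  one := ⟨fun _ => 1, fun _ _ => rfl⟩
  mul_one S x := by
    refine Subtype.ext (funext fun ⟨s, _⟩ => ?_)
    refine Eq.trans ?_ (burnMap_tr_apply (Representation.trivial ℤ G ℤ) (rightUnitMap S)
      (fun _ _ h => congrArg Prod.fst h) x s).symm
    exact one_zsmul _
  one_mul S x := by
    refine Subtype.ext (funext fun ⟨_, s⟩ => ?_)
    refine Eq.trans ?_ (burnMap_tr_apply (Representation.trivial ℤ G ℤ) (leftUnitMap S)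
      (fun _ _ h => congrArg Prod.snd h) x s).symm
    exact mul_one _
  mul_assoc S T U x y z := by
    refine Subtype.ext (funext fun ⟨s, t, u⟩ => ?_)
    refine (burnMap_tr_apply (Representation.trivial ℤ G ℤ) (assocMap S T U)
      (Equiv.prodAssoc S T U).injective _ ((s, t), u)).trans ?_
    exact (_root_.mul_assoc _ _ _).symm
  mul_comm S T x y := by
    refine Subtype.ext (funext fun ⟨t, s⟩ => ?_)
    refine (burnMap_tr_apply (Representation.trivial ℤ G ℤ) (swapMap S T)
      (Equiv.prodComm S T).injective _ (s, t)).trans ?_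
    exact _root_.mul_comm _ _

end ConstantGreenFunctor

section TensorFixedPoints

variable {G : Type u} [Group G] {V : Type u} [AddCommGroup V] [Module ℤ V]
  (ρ : Representation ℤ G V) (A : AddCommGrpCat.{u})

/-- The functor `T ↦ A ⊗ Map_G(T, V)`. -/
noncomputable abbrev tensorFunctor : Burnside G ⥤ AddCommGrpCat.{u} where
  obj T := AddCommGrpCat.of (A ⊗[ℤ] equivMaps ρ T)
  map {T U} f := AddCommGrpCat.ofHom ((burnMap ρ T U f).lTensor A).toAddMonoidHom
  map_id T := by rw [burnMap_id, LinearMap.lTensor_id]; rfl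
  map_comp f k := by rw [burnMap_comp, LinearMap.lTensor_comp]; rfl

instance : (tensorFunctor ρ A).Additive where
  map_add {T U f k} := by
    refine AddCommGrpCat.hom_ext (AddMonoidHom.ext fun x => ?_)
    change (burnMap ρ T U (f + k)).lTensor A x =
      (burnMap ρ T U f).lTensor A x + (burnMap ρ T U k).lTensor A x
    rw [← LinearMap.add_apply, ← LinearMap.lTensor_add, ← burnMap_add]

/-- The action of a `G`-invariant function `ψ : T → ℤ` on `A ⊗ Map_G(S, V)` by external
product: `(a ⊗ φ) · ψ = a ⊗ ((s, t) ↦ ψ(t) φ(s))`. -/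
noncomputable def tensorAct (S T : FinGSet G) :
    (A ⊗[ℤ] equivMaps ρ S) →+ equivMaps (Representation.trivial ℤ G ℤ) T →+
      (A ⊗[ℤ] equivMaps ρ (S.prod T)) :=
  AddMonoidHom.mk'
    (fun x => AddMonoidHom.mk' (fun ψ => (extMul ρ S T ψ).lTensor A x) fun ψ ψ' => by
      rw [map_add, LinearMap.lTensor_add, LinearMap.add_apply])
    fun x x' => AddMonoidHom.ext fun ψ => map_add ((extMul ρ S T ψ).lTensor A) x x'

/-- The `ℤ`-module `T ↦ A ⊗ Map_G(T, V)`, where the constant Green functor acts through the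
external product on the second factor. -/
noncomputable def tensorModule : GreenModule (constZ G) where
  mackey := AdditiveFunctor.of (tensorFunctor ρ A)
  act S T := tensorAct ρ A S T
  act_natural {S S' T T'} f k m r := by
    refine (LinearMap.lTensor_comp_apply A _ _ m).symm.trans
      (Eq.trans ?_ (LinearMap.lTensor_comp_apply A _ _ m))
    refine congrArg (fun l => LinearMap.lTensor A l m) (LinearMap.ext fun φ => ?_)
    exact extMul_natural ρ f k φ r
  act_one S m := by
    refine congrArg (fun l => LinearMap.lTensor A l m) (LinearMap.ext fun φ => ?_)
    refine Subtype.ext (funext fun ⟨s, _⟩ => ?_)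
    refine Eq.trans ?_ (burnMap_tr_apply ρ (rightUnitMap S)
      (fun _ _ h => congrArg Prod.fst h) φ s).symm
    exact one_zsmul _
  act_assoc S T U m r r' := by
    refine (LinearMap.lTensor_comp_apply A _ _ _).symm.trans
      ((LinearMap.lTensor_comp_apply A _ _ m).symm.trans ?_)
    refine congrArg (fun l => LinearMap.lTensor A l m) (LinearMap.ext fun φ => ?_)
    refine Subtype.ext (funext fun ⟨s, t, u⟩ => ?_)
    refine (burnMap_tr_apply ρ (assocMap S T U)
      (Equiv.prodAssoc S T U).injective _ ((s, t), u)).trans ?_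
    exact smul_smul (M := ℤ) ((show equivMaps (Representation.trivial ℤ G ℤ) U from r').1 u)
      ((show equivMaps (Representation.trivial ℤ G ℤ) T from r).1 t) (φ.1 s)

lemma rTensor_lTensor_apply {B B' M N : Type*} [AddCommGroup B] [AddCommGroup B']
    [AddCommGroup M] [AddCommGroup N] [Module ℤ B] [Module ℤ B'] [Module ℤ M] [Module ℤ N]
    (f : B →ₗ[ℤ] B') (l : M →ₗ[ℤ] N) (x : B ⊗[ℤ] M) :
    f.rTensor N (l.lTensor B x) = l.lTensor B' (f.rTensor M x) := by
  rw [← LinearMap.comp_apply, ← LinearMap.comp_apply, LinearMap.rTensor_comp_lTensor,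
    LinearMap.lTensor_comp_rTensor]

variable {A} in
/-- The morphism of `ℤ`-modules induced by a homomorphism of abelian groups `A → A'`. -/
noncomputable def tensorModuleMap {A' : AddCommGrpCat.{u}} (f : A ⟶ A') :
    tensorModule ρ A ⟶ tensorModule ρ A' where
  hom := ObjectProperty.homMk
    { app := fun T => AddCommGrpCat.ofHom
        (f.hom.toIntLinearMap.rTensor (equivMaps ρ T)).toAddMonoidHom
      naturality := fun T U k => AddCommGrpCat.hom_ext <| AddMonoidHom.ext fun x =>
        rTensor_lTensor_apply f.hom.toIntLinearMap (burnMap ρ T U k) x }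
  map_act S T m r := rTensor_lTensor_apply f.hom.toIntLinearMap (extMul ρ S T r) m

/-- The functor `A ↦ (T ↦ A ⊗ Map_G(T, V))` from abelian groups to `ℤ`-modules. -/
noncomputable def tensorModuleFunctor : AddCommGrpCat.{u} ⥤ GreenModule (constZ G) where
  obj A := tensorModule ρ A
  map f := tensorModuleMap ρ f
  map_id A := by
    refine GreenModule.Hom.ext (ObjectProperty.hom_ext _ (NatTrans.ext (funext fun T => ?_)))
    refine AddCommGrpCat.hom_ext (AddMonoidHom.ext fun x => ?_)
    exact LinearMap.rTensor_id_apply _ _ x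
  map_comp f k := by
    refine GreenModule.Hom.ext (ObjectProperty.hom_ext _ (NatTrans.ext (funext fun T => ?_)))
    refine AddCommGrpCat.hom_ext (AddMonoidHom.ext fun x => ?_)
    exact LinearMap.rTensor_comp_apply _ k.hom.toIntLinearMap f.hom.toIntLinearMap x

end TensorFixedPoints

section Orbits

variable {G : Type u} [Group G]

/-- The permutation representation `ℤ(G/H)`. -/
noncomputable abbrev permRep (H : Subgroup G) :
    Representation ℤ G (MonoidAlgebra ℤ (G ⧸ H)) :=
  Representation.ofMulAction ℤ G (G ⧸ H)

/-- The functor `Ξ_{G/H}` from abelian groups to `ℤ`-modules. Its value on `A` is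
`T ↦ A ⊗ Map_G(T, ℤ(G/H))`, so `G/K ↦ A ⊗ (ℤ(G/H))^K`. -/
noncomputable def Xi (H : Subgroup G) : AddCommGrpCat.{u} ⥤ GreenModule (constZ G) :=
  tensorModuleFunctor (permRep H)

section

variable {V : Type v} [AddCommGroup V] [Module ℤ V] (ρ : Representation ℤ G V)

/-- The fixed points `V^K`. -/
noncomputable abbrev fixedPts (K : Subgroup G) : Submodule ℤ V :=
  Representation.invariants (MonoidHom.comp ρ K.subtype)

lemma mem_fixedPts {K : Subgroup G} {v : V} : v ∈ fixedPts ρ K ↔ ∀ k ∈ K, ρ k v = v :=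
  ⟨fun h k hk => h ⟨k, hk⟩, fun h k => h k.1 k.2⟩

/-- The inclusion `V^L ⊆ V^K` for `K ≤ L`. -/
noncomputable def fixedIncl {K L : Subgroup G} (h : K ≤ L) :
    fixedPts ρ L →ₗ[ℤ] fixedPts ρ K := toLin <|
  AddMonoidHom.mk' (fun v => ⟨v.1, (mem_fixedPts ρ).2 fun k hk =>
    (mem_fixedPts ρ).1 v.2 k (h hk)⟩) fun _ _ => rfl

/-- The translate `γ v` of `v ∈ V^K`, for a coset `γ K` with `γ ∈ L`. -/
noncomputable def cosetSmul {K : Subgroup G} (L : Subgroup G) (v : fixedPts ρ K)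
    (q : L ⧸ K.subgroupOf L) : V :=
  Quotient.liftOn' q (fun γ => ρ (γ : G) (v : V)) fun a b hab => by
    have h0 : a⁻¹ * b ∈ K.subgroupOf L := QuotientGroup.leftRel_apply.1 hab
    have h : ((a⁻¹ * b : L) : G) ∈ K := Subgroup.mem_subgroupOf.1 h0
    have h2 := congrArg (ρ (a : G)) ((mem_fixedPts ρ).1 v.2 _ h)
    rw [← Module.End.mul_apply, ← map_mul] at h2
    simpa using h2.symm

/-- The sum `v ↦ ∑_{γ ∈ L/K} γ v` over coset representatives, from `V^K` to `V^L`, for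
`K ≤ L`. -/
noncomputable def cosetSum [Finite G] (K L : Subgroup G) :
    fixedPts ρ K →ₗ[ℤ] fixedPts ρ L := toLin <|
  haveI := Fintype.ofFinite (L ⧸ K.subgroupOf L)
  AddMonoidHom.mk'
    (fun v => ⟨∑ q, cosetSmul ρ L v q, (mem_fixedPts ρ).2 fun g hg => by
      rw [map_sum]
      refine Fintype.sum_equiv (MulAction.toPerm (⟨g, hg⟩ : L)) _ _ fun q => ?_
      induction q using QuotientGroup.induction_on with
      | H γ =>
        change ρ g (ρ (γ : G) v) = ρ ((g * γ : G)) v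
        rw [map_mul]; rfl⟩)
    fun v w => by
      refine Subtype.ext (Eq.trans (Finset.sum_congr rfl fun q _ => ?_) Finset.sum_add_distrib)
      induction q using QuotientGroup.induction_on with
      | H γ => exact map_add (ρ (γ : G)) v.1 w.1

variable [Finite G]

/-- Evaluation at the coset `K`, from `Map_G(G/K, V)` to `V^K`. -/
noncomputable def evalCoset (K : Subgroup G) : equivMaps ρ (orbit K) →ₗ[ℤ] fixedPts ρ K := toLin <|
  AddMonoidHom.mk' (fun φ => ⟨φ.1 ((1 : G) : G ⧸ K), (mem_fixedPts ρ).2 fun k hk => by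
    rw [← φ.2 k]
    exact congrArg φ.1 (QuotientGroup.eq.2 (by simpa using hk))⟩) fun _ _ => rfl

end

variable [Finite G]

/-- The projection `G/K → G/L` for `K ≤ L`. -/
def orbitProj {K L : Subgroup G} (h : K ≤ L) : orbit K →[G] orbit L :=
  ⟨Subgroup.quotientMapOfLE h, fun g x => by
    induction x using QuotientGroup.induction_on with
    | H γ => rfl⟩

/-- The identification `Ξ_{G/H}(A)(G/K) → A ⊗ (ℤ(G/H))^K`, given by `a ⊗ φ ↦ a ⊗ φ(K)`. -/
noncomputable def XiOrbit (H : Subgroup G) (A : AddCommGrpCat.{u}) (K : Subgroup G) :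
    ((Xi H).obj A).mackey.val (orbit K) →+ A ⊗[ℤ] fixedPts (permRep H) K :=
  ((evalCoset (permRep H) K).lTensor A).toAddMonoidHom

end Orbits

section CoefficientSystems

variable (G : Type u) [Group G]

/-- The orbit category of `G`: its objects are the orbits `G/K`, its morphisms are the
`G`-maps. -/
structure OrbitCat where
  stab : Subgroup G

variable {G}

instance : Category.{u} (OrbitCat G) where
  Hom K L := (G ⧸ K.stab) →[G] (G ⧸ L.stab)
  id _ := MulActionHom.id G
  comp f k := MulActionHom.comp k f

/-- A coefficient system. -/
abbrev CoeffSystem (G : Type u) [Group G] := (OrbitCat G)ᵒᵖ ⥤ AddCommGrpCat.{u}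

/-- The coefficient system `A ⊗ F_{G/H}`, that is `G/K ↦ A ⊗ ℤ Map_G(G/K, G/H)`. -/
noncomputable def coeffFree (H : Subgroup G) (A : AddCommGrpCat.{u}) : CoeffSystem G where
  obj K := AddCommGrpCat.of (A ⊗[ℤ] (((G ⧸ K.unop.stab) →[G] (G ⧸ H)) →₀ ℤ))
  map f := AddCommGrpCat.ofHom
    ((Finsupp.lmapDomain ℤ ℤ fun k => MulActionHom.comp k f.unop).lTensor A).toAddMonoidHom
  map_id K := by
    refine AddCommGrpCat.hom_ext (AddMonoidHom.ext fun x => ?_)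
    refine Eq.trans (congrArg (fun l => LinearMap.lTensor A l x) ?_) (LinearMap.lTensor_id_apply _ _ x)
    exact Finsupp.lmapDomain_id ℤ ℤ
  map_comp f k := by
    refine AddCommGrpCat.hom_ext (AddMonoidHom.ext fun x => ?_)
    refine Eq.trans (congrArg (fun l => LinearMap.lTensor A l x) ?_)
      (LinearMap.lTensor_comp_apply _ _ _ x)
    exact Finsupp.lmapDomain_comp ℤ ℤ (fun l => MulActionHom.comp l f.unop)
      (fun l => MulActionHom.comp l k.unop)

variable [Finite G]

/-- The functor from the opposite of the orbit category to the Burnside category that takes a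
`G`-map `f : X → Y` to the span `Y ← X = X`. -/
noncomputable def orbitToBurnside : (OrbitCat G)ᵒᵖ ⥤ Burnside G where
  obj K := orbit K.unop.stab
  map {K L} f := res (X := orbit L.unop.stab) (Y := orbit K.unop.stab) f.unop
  map_id K := res_id (orbit K.unop.stab)
  map_comp {K L M} f k := res_comp (X := orbit M.unop.stab) (Y := orbit L.unop.stab)
    (Z := orbit K.unop.stab) k.unop f.unop

/-- The functor that takes a Mackey functor to its underlying coefficient system. -/
noncomputable def toCoeff : Mackey G ⥤ CoeffSystem G where
  obj M := orbitToBurnside ⋙ M.obj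
  map α := Functor.whiskerLeft orbitToBurnside α.hom

/-- The `G`-map `G/K → ℤ(G/H)` given by a `G`-map `f : G/K → G/H`. -/
noncomputable def permMap (H K : Subgroup G) (f : orbit K →[G] orbit H) :
    equivMaps (permRep H) (orbit K) :=
  ⟨fun x => MonoidAlgebra.single (f x) 1, fun g x => by
    exact (congrArg (fun y => MonoidAlgebra.single y (1 : ℤ)) (map_smul f g x)).trans
      (Representation.ofMulAction_single g (f x) 1).symm⟩

/-- The homomorphism `A ⊗ ℤ Map_G(G/K, G/H) → A ⊗ Map_G(G/K, ℤ(G/H))` that is induced by the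
inclusion of the set `G/H` into `ℤ(G/H)`. -/
noncomputable def linearize (H : Subgroup G) (A : AddCommGrpCat.{u}) (K : Subgroup G) :
    A ⊗[ℤ] (((G ⧸ K) →[G] (G ⧸ H)) →₀ ℤ) →ₗ[ℤ] A ⊗[ℤ] equivMaps (permRep H) (orbit K) :=
  (Finsupp.linearCombination ℤ (permMap H K)).lTensor A

/-- The canonical map of coefficient systems `A ⊗ F_{G/H} ⟶ Ξ_{G/H}(A)`, which takes `a ⊗ f`, for
a `G`-map `f : G/K → G/H`, to `a ⊗ f`; under the identification of `Map_G(G/K, ℤ(G/H))` with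
`(ℤ(G/H))^K`, this is `a ⊗ f(K)`. -/
noncomputable def XiUnit (H : Subgroup G) (A : AddCommGrpCat.{u}) :
    coeffFree H A ⟶ toCoeff.obj ((Xi H).obj A).mackey where
  app K := AddCommGrpCat.ofHom (linearize H A K.unop.stab).toAddMonoidHom
  naturality K L f := by
    refine AddCommGrpCat.hom_ext (AddMonoidHom.ext fun x => ?_)
    refine (LinearMap.lTensor_comp_apply A _ _ x).symm.trans
      (Eq.trans ?_ (LinearMap.lTensor_comp_apply A _ _ x))
    refine congrArg (fun l => LinearMap.lTensor A l x) (Finsupp.lhom_ext' fun k => ?_)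
    refine LinearMap.ext_ring ?_
    change Finsupp.linearCombination ℤ (permMap H L.unop.stab)
        (Finsupp.mapDomain (fun l => MulActionHom.comp l f.unop) (Finsupp.single k 1)) =
      burnMap (permRep H) (orbit K.unop.stab) (orbit L.unop.stab) (orbitToBurnside.map f)
        (Finsupp.linearCombination ℤ (permMap H K.unop.stab) (Finsupp.single k 1))
    rw [Finsupp.mapDomain_single, Finsupp.linearCombination_single,
      Finsupp.linearCombination_single, one_smul, one_smul]
    refine Subtype.ext (funext fun y => ?_)
    exact (burnMap_res_apply (permRep H) (T := orbit L.unop.stab) (U := orbit K.unop.stab)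
      f.unop (permMap H K.unop.stab k) y).symm

end CoefficientSystems

end MackeyTheory

open MackeyTheory MackeyTheory.FinGSet MackeyTheory.Burnside

/-! Write `X = G/H`. Reading off coefficients identifies `Map_G(T, ℤ(X))` with the `G`-invariant
functions on `X × T`, so `Ξ_{G/H}(ℤ)` is the constant Green functor evaluated at `X × T`. Since `X`
is self-dual in the Burnside category, this is the free module on one generator at `X`, namely the
inclusion of `X` into `ℤ(X)` (`genMap`).

Concretely, `pairing X T` is the duality evaluation on `X`, carried along with a spectator `T`.
Expanding `φ(t) = ∑_x φ(t)_x x` in the basis `X` says that `φ` is the image under `pairing` of the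
product of the generator with the coefficient function of `φ` (`burnMap_pairing_genMap`). A module
morphism out of `Ξ_{G/H}(A)` is therefore determined by its values on the elements `a ⊗ genMap`
(`Xi_hom_ext`), and the same formula dictates the extension of a homomorphism `θ : A → M(X)`: send
`a ⊗ φ` to the image under `pairing` of `θ(a)` times the coefficients of `φ`. It is a morphism of
Mackey functors because `pairing` is natural in `T`, it respects the action because the action is
associative, and it restores `θ` on generators by unitality and the triangle identity for the
duality (`extend_genMap`). This yields the adjunction.

On the side of coefficient systems, Yoneda's lemma makes `A ⊗ F_{G/H}` free on the elements `a ⊗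
id`, which the unit sends to `a ⊗ genMap`; the universal property is thus the adjunction in another
form. The description of values, restrictions and transfers rests on the fact that a `G`-map out of
`G/K` is determined by its value at the coset `K`, which can be any `K`-fixed vector. -/

namespace MackeyTheory

/-! ### Self-duality of finite `G`-sets in the Burnside category -/

section Pairing

open FinGSet Burnside

variable {G : Type u} [Group G]

/-- The span `X × (X × T) ← X × T → T` given by the diagonal of `X` and the projection; it is the
evaluation morphism that exhibits `X` as self-dual in the Burnside category. -/
noncomputable def pairing (X T : FinGSet G) : (X.prod (X.prod T) : Burnside G) ⟶ T :=
  ofSpan ⟨X.prod T, ⟨fun p => (p.1, (p.1, p.2)), fun _ _ => rfl⟩, ⟨Prod.snd, fun _ _ => rfl⟩⟩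

/-- When `f` is a span `T ← S → U`, both composites are the span `X × (X × T) ← X × S → U`, whose
left leg repeats the coordinate in `X`; biadditivity extends this to formal differences. It lets an
induced map be moved past the pairing. -/
lemma pairing_naturality (X : FinGSet G) {T U : FinGSet G} (f : (T : Burnside G) ⟶ U) :
    pairing X T ≫ f = prodMap (𝟙 (X : Burnside G)) (prodMap (𝟙 (X : Burnside G)) f) ≫
      pairing X U := by
  change compHom _ _ _ (pairing X T) f = compHom _ _ _
    (prodHom _ _ _ _ (ofSpan (GSpan.id X)) (prodHom _ _ _ _ (ofSpan (GSpan.id X)) f)) (pairing X U)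
  induction f using hom_ind with
  | sub x y hx hy => simp only [map_sub, AddMonoidHom.sub_apply, hx, hy]
  | of s =>
    rw [prodHom_ofSpan, prodHom_ofSpan]
    refine (compHom_ofSpan _ _).trans (Eq.trans (ofSpan_sound ?_) (compHom_ofSpan _ _).symm)
    -- A point of the first pullback is `((x, t), a)` with `t = s.left a`, hence just a pair `(x,
    -- a)`. The diagonal in the pairing forces a point of the second pullback to be determined by
    -- such a pair as well.
    refine ⟨⟨fun p => ⟨(p.fst.1, (p.fst.1, p.snd)), (p.fst.1, s.right p.snd), rfl⟩, ?_⟩,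
      ⟨?_, ?_⟩, ?_, fun p => rfl⟩
    · intro g p
      exact Pb.ext rfl (Prod.ext rfl (map_smul s.right g p.snd))
    · rintro ⟨⟨x, t⟩, a, h⟩ ⟨⟨x', t'⟩, a', h'⟩ hh
      obtain rfl : x = x' := congrArg (fun p => p.fst.1) hh
      obtain rfl : a = a' := congrArg (fun p => p.fst.2.2) hh
      exact Pb.ext (Prod.ext rfl (Eq.trans h h'.symm)) rfl
    · rintro ⟨⟨x, y, a⟩, ⟨z, w⟩, h⟩
      obtain rfl : x = z := congrArg (fun p => p.1) h
      obtain rfl : y = x := congrArg (fun p => p.2.1) h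
      obtain rfl : s.right a = w := congrArg (fun p => p.2.2) h
      exact ⟨⟨(y, s.left a), a, rfl⟩, rfl⟩
    · intro p
      exact Prod.ext rfl (Prod.ext rfl p.eq.symm)

/-- The pairing for a product `S × T` is the product of the pairing for `S` with `T`. -/
lemma prodMap_pairing_id (X S T : FinGSet G) :
    prodMap (pairing X S) (𝟙 (T : Burnside G)) =
      tr (assocMap X (X.prod S) T) ≫ prodMap (𝟙 (X : Burnside G)) (tr (assocMap X S T)) ≫
        pairing X (S.prod T) := by
  refine (prodHom_ofSpan _ _).trans (Eq.symm ?_)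
  refine (congrArg (fun k => compHom _ _ _ (tr (assocMap X (X.prod S) T))
    (compHom _ _ _ k (pairing X (S.prod T)))) (prodHom_ofSpan (GSpan.id X) _)).trans ?_
  refine (congrArg (compHom _ _ _ _) (compHom_ofSpan _ _)).trans
    ((compHom_ofSpan _ _).trans (ofSpan_sound (GSpan.Isom.symm ?_)))
  -- The isomorphism is built out of the smaller apex `(X × S) × T`: its points fill in all
  -- coordinates of the iterated pullback, and surjectivity amounts to the pullback equations
  -- forcing the repeated coordinates to agree.
  refine ⟨⟨fun p => ⟨((p.1.1, (p.1.1, p.1.2)), p.2),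
    ⟨(p.1.1, ((p.1.1, p.1.2), p.2)), (p.1.1, (p.1.2, p.2)), rfl⟩, rfl⟩, fun _ _ => rfl⟩,
    ⟨?_, ?_⟩, fun p => rfl, fun p => rfl⟩
  · intro p q hh
    have h := congrArg (fun p => p.snd.snd) hh
    exact Prod.ext (Prod.ext (congrArg (fun p => p.1) h) (congrArg (fun p => p.2.1) h))
      (congrArg (fun p => p.2.2) h)
  · rintro ⟨⟨⟨a, b, c⟩, d⟩, ⟨⟨a', ⟨b', c'⟩, d'⟩, ⟨x, y, z⟩, h⟩, h'⟩
    obtain rfl : a = a' := congrArg (fun p => p.1) h'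
    obtain rfl : b = b' := congrArg (fun p => p.2.1.1) h'
    obtain rfl : c = c' := congrArg (fun p => p.2.1.2) h'
    obtain rfl : d = d' := congrArg (fun p => p.2.2) h'
    obtain rfl : a = x := congrArg (fun p => p.1) h
    obtain rfl : b = a := congrArg (fun p => p.2.1) h
    obtain rfl : c = y := congrArg (fun p => p.2.2.1) h
    obtain rfl : d = z := congrArg (fun p => p.2.2.2) h
    exact ⟨((b, c), d), rfl⟩

/-- The map to the one-point `G`-set. -/
def toPt (X : FinGSet G) : X →[G] pt G := ⟨fun _ => ⟨⟩, fun _ _ => rfl⟩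

/-- The diagonal of a finite `G`-set. -/
def diagMap (X : FinGSet G) : X →[G] X.prod X := ⟨fun x => (x, x), fun _ _ => rfl⟩

/-- The triangle identity for the self-duality of `X`. -/
lemma pairing_triangle (X : FinGSet G) :
    tr (rightUnitMap X) ≫ prodMap (𝟙 (X : Burnside G)) (res (toPt X) ≫ tr (diagMap X)) ≫
      pairing X X = 𝟙 (X : Burnside G) := by
  refine (congrArg (fun k => compHom _ _ _ (tr (rightUnitMap X)) (compHom _ _ _
    (prodHom _ _ _ _ (ofSpan (GSpan.id X)) k) (pairing X X))) (compHom_ofSpan _ _)).trans ?_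
  refine (congrArg (fun k => compHom _ _ _ (tr (rightUnitMap X))
    (compHom _ _ _ k (pairing X X))) (prodHom_ofSpan (GSpan.id X) _)).trans ?_
  refine (congrArg (compHom _ _ _ _) (compHom_ofSpan _ _)).trans
    ((compHom_ofSpan _ _).trans (ofSpan_sound (GSpan.Isom.symm ?_)))
  -- The two diagonals, one from `diagMap` and one from the pairing, force every coordinate of the
  -- iterated pullback to be the same point of `X`.
  refine ⟨⟨fun x => ⟨x, ⟨(x, ⟨x, x, rfl⟩), (x, x), rfl⟩, rfl⟩, fun _ _ => rfl⟩,
    ⟨?_, ?_⟩, fun p => rfl, fun p => rfl⟩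
  · intro p q hh
    exact congrArg (fun p => p.fst) hh
  · rintro ⟨a, ⟨⟨b, ⟨c, d, h1⟩⟩, ⟨x, y⟩, h⟩, h'⟩
    obtain rfl : a = b := congrArg (fun p => p.1) h'
    obtain rfl : c = d := h1
    obtain rfl : a = x := congrArg (fun p => p.1) h
    obtain rfl : c = a := congrArg (fun p => p.2.1) h
    obtain rfl : c = y := congrArg (fun p => p.2.2) h
    exact ⟨c, rfl⟩

end Pairing

/-! ### Functoriality, and naturality of the action in one variable -/

section Induced

open FinGSet Burnside

variable {G : Type u} [Group G]

lemma ind_comp (N : Mackey G) {T U V : FinGSet G} (f : (T : Burnside G) ⟶ U)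
    (k : (U : Burnside G) ⟶ V) (x : N.val T) : N.ind (f ≫ k) x = N.ind k (N.ind f x) :=
  congrArg (fun l => l.hom x) (N.obj.map_comp f k)

lemma ind_id (N : Mackey G) {T : FinGSet G} (x : N.val T) :
    N.ind (𝟙 (T : Burnside G)) x = x :=
  congrArg (fun l => l.hom x) (N.obj.map_id T)

lemma comp_ind {N N' : Mackey G} (α : N ⟶ N') {T U : FinGSet G} (f : (T : Burnside G) ⟶ U)
    (x : N.val T) : Mackey.comp α U (N.ind f x) = N'.ind f (Mackey.comp α T x) :=
  congrArg (fun l => l.hom x) (α.hom.naturality f)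

lemma act_ind_right {R : GreenFunctor G} (M : GreenModule R) {S T T' : FinGSet G}
    (k : (T : Burnside G) ⟶ T') (m : M.mackey.val S) (r : R.mackey.val T) :
    M.act S T' m (R.mackey.ind k r) =
      M.mackey.ind (prodMap (𝟙 (S : Burnside G)) k) (M.act S T m r) := by
  rw [← M.act_natural, ind_id]

lemma act_ind_left {R : GreenFunctor G} (M : GreenModule R) {S S' T : FinGSet G}
    (f : (S : Burnside G) ⟶ S') (m : M.mackey.val S) (r : R.mackey.val T) :
    M.act S' T (M.mackey.ind f m) r =
      M.mackey.ind (prodMap f (𝟙 (T : Burnside G))) (M.act S T m r) := by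
  rw [← M.act_natural, ind_id]

end Induced
end MackeyTheory

namespace MackeyTheory

/-! ### `Ξ_{G/H}(A)` as the free module on `A` at `G/H` -/

section FreeModule

open FinGSet Burnside Classical

variable {G : Type u} [Group G] [Finite G] (H : Subgroup G)

/-- The `G`-invariant function `(x, t) ↦ φ(t)_x` of coefficients of a `G`-map
`φ : T → ℤ(G/H)`. -/
noncomputable def coeffMap (T : FinGSet G) :
    equivMaps (permRep H) T →ₗ[ℤ] equivMaps (Representation.trivial ℤ G ℤ) ((orbit H).prod T) :=
  toLin <| AddMonoidHom.mk' (fun φ => ⟨fun p => (φ.1 p.2).coeff p.1, fun g p => by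
    rw [Representation.trivial_apply]
    change (φ.1 (g • p.2)).coeff (g • p.1) = _
    rw [φ.2, Representation.coeff_ofMulAction, inv_smul_smul]⟩)
    fun _ _ => Subtype.ext (funext fun _ => rfl)

lemma coeffMap_apply {T : FinGSet G} (φ : equivMaps (permRep H) T) (p : (orbit H).prod T) :
    (coeffMap H T φ).1 p = (φ.1 p.2).coeff p.1 := rfl

/-- Pulling back and summing over fibres act on the variable in `T` only, and taking the coefficient
at a fixed point of `G/H` is additive. Together with `coeffMap_extMul`, this transports the module
structure of `Ξ_{G/H}(ℤ)` to invariant functions on `G/H × T`. -/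
lemma coeffMap_natural {T U : FinGSet G} (f : (T : Burnside G) ⟶ U)
    (φ : equivMaps (permRep H) T) :
    coeffMap H U (burnMap (permRep H) T U f φ) =
      burnMap (Representation.trivial ℤ G ℤ) ((orbit H).prod T) ((orbit H).prod U)
        (prodMap (𝟙 (orbit H : Burnside G)) f) (coeffMap H T φ) := by
  change _ = burnMap (Representation.trivial ℤ G ℤ) ((orbit H).prod T) ((orbit H).prod U)
    (prodHom _ _ _ _ (ofSpan (GSpan.id (orbit H))) f) (coeffMap H T φ)
  induction f using hom_ind with
  | sub x y hx hy => simp only [map_sub, LinearMap.sub_apply, hx, hy]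
  | of s =>
    rw [prodHom_ofSpan, burnMap_ofSpan, burnMap_ofSpan]
    refine Subtype.ext (funext fun ⟨x, u⟩ => ?_)
    rw [coeffMap_apply, spanMap_apply, spanMap_apply]
    have : Fintype (orbit H) := Fintype.ofFinite _
    -- The sum carries the enumeration chosen for a general finite `G`-set; the product enumeration
    -- is substituted so that it can be written as an iterated sum.
    refine Eq.trans ?_ (sum_fintype_irrel (instFintypeProd (orbit H) s.apex) _ _)
    rw [Fintype.sum_prod_type]
    have h : ∀ (y : orbit H) (a : s.apex),
        (((GSpan.id (orbit H)).prod s).right (y, a) = ((x, u) : (orbit H).prod U)) ↔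
          y = x ∧ s.right a = u := fun y a => Prod.mk_inj
    -- The identity leg on `G/H` leaves only the terms whose first coordinate is `x`.
    rw [Finset.sum_eq_single x]
    · change (MonoidAlgebra.coeffLinearEquiv ℤ (M := G ⧸ H) _) x = _
      rw [map_sum, Finsupp.finsetSum_apply]
      refine Finset.sum_congr rfl fun a _ => ?_
      by_cases h1 : s.right a = u
      · rw [if_pos h1, if_pos ((h x a).2 ⟨rfl, h1⟩)]; rfl
      · rw [if_neg h1, if_neg fun h' => h1 ((h x a).1 h').2]; rfl
    · intro y _ hy
      exact Finset.sum_eq_zero fun a _ => if_neg fun h' => hy ((h y a).1 h').1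
    · exact fun h' => (h' (Finset.mem_univ _)).elim

/-- At `(x, (s, t))` both sides are `r(t) φ(s)_x`; the transfer along the bijection `assocMap` only
re-brackets the argument. -/
lemma coeffMap_extMul (S T : FinGSet G) (φ : equivMaps (permRep H) S)
    (r : equivMaps (Representation.trivial ℤ G ℤ) T) :
    coeffMap H (S.prod T) (extMul (permRep H) S T r φ) =
      burnMap (Representation.trivial ℤ G ℤ) _ _ (tr (assocMap (orbit H) S T))
        (constMul G ((orbit H).prod S) T (coeffMap H S φ) r) := by
  refine Subtype.ext (funext fun ⟨x, s, t⟩ => Eq.trans ?_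
    (burnMap_tr_apply (Representation.trivial ℤ G ℤ) (assocMap (orbit H) S T)
      (Equiv.prodAssoc (orbit H) S T).injective _ ((x, s), t)).symm)
  rfl

/-- The canonical generator of `Map_G(G/H, ℤ(G/H))`. -/
noncomputable abbrev genMap : equivMaps (permRep H) (orbit H) := permMap H H (MulActionHom.id G)

/-- The coefficient of `y` at `x` is the indicator of the diagonal, which is the transfer along the
diagonal of the constant function `1`. Expressing it through the unit of the Green functor makes
unitality of an action applicable. -/
lemma coeffMap_genMap : coeffMap H (orbit H) (genMap H) =
    burnMap (Representation.trivial ℤ G ℤ) _ _ (res (toPt (orbit H)) ≫ tr (diagMap (orbit H)))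
      (constZ G).one := by
  refine Eq.trans ?_ (congrArg (fun l => l (constZ G).one)
    (burnMap_comp (Representation.trivial ℤ G ℤ) _ _)).symm
  change _ = burnMap (Representation.trivial ℤ G ℤ) _ _ (tr (diagMap (orbit H)))
    (burnMap (Representation.trivial ℤ G ℤ) _ _ (res (toPt (orbit H))) (constZ G).one)
  refine Subtype.ext (funext fun ⟨x, y⟩ => ?_)
  rw [coeffMap_apply, tr, burnMap_ofSpan, spanMap_apply]
  change (MonoidAlgebra.single y (1 : ℤ)).coeff x = _
  rw [MonoidAlgebra.coeff_single, Finsupp.single_apply]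
  have h : ∀ z : orbit H, ((diagMap (orbit H) z) = ((x, y) : (orbit H).prod (orbit H))) ↔
      z = x ∧ z = y := fun z => Prod.mk_inj
  rw [Finset.sum_eq_single x]
  · by_cases hxy : y = x
    · rw [if_pos hxy]
      refine Eq.trans ?_ (if_pos ((h x).2 ⟨rfl, hxy.symm⟩)).symm
      exact (burnMap_res_apply _ (toPt (orbit H)) (constZ G).one x).symm
    · rw [if_neg hxy]
      exact (if_neg fun h' => hxy ((h x).1 h').2.symm).symm
  · exact fun z _ hz => if_neg fun h' => hz ((h z).1 h').1
  · exact fun h' => (h' (@Finset.mem_univ _ (_) _)).elim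

variable {H}

/-- At `t` this is the basis expansion `∑_x φ(t)_x x = φ(t)`. It shows that `genMap` generates under
the action and the maps of the Burnside category. -/
lemma burnMap_pairing_genMap {T : FinGSet G} (φ : equivMaps (permRep H) T) :
    burnMap (permRep H) _ T (pairing (orbit H) T)
      (extMul (permRep H) (orbit H) ((orbit H).prod T) (coeffMap H T φ) (genMap H)) = φ := by
  refine Subtype.ext (funext fun t => ?_)
  rw [pairing, burnMap_ofSpan, spanMap_apply]
  have : Fintype (orbit H) := Fintype.ofFinite _
  refine Eq.trans (sum_fintype_irrel _ (instFintypeProd (orbit H) T) _) ?_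
  rw [Fintype.sum_prod_type]
  refine Eq.trans (Finset.sum_congr rfl fun x _ => Finset.sum_ite_eq' Finset.univ t
    fun s => (coeffMap H T φ).1 (x, s) • (genMap H).1 x) ?_
  simp only [Finset.mem_univ, if_true]
  refine MonoidAlgebra.ext (Finsupp.ext fun y => ?_)
  change (MonoidAlgebra.coeffLinearEquiv ℤ (M := G ⧸ H) _) y = _
  rw [map_sum, Finsupp.finsetSum_apply, Finset.sum_eq_single y]
  · change (φ.1 t).coeff y * Finsupp.single y (1 : ℤ) y = _
    rw [Finsupp.single_eq_same, mul_one]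
  · intro x _ hx
    change (φ.1 t).coeff x * Finsupp.single x (1 : ℤ) y = _
    rw [Finsupp.single_eq_of_ne hx.symm, mul_zero]
  · exact fun h' => (h' (Finset.mem_univ _)).elim

variable {A : AddCommGrpCat.{u}} {M : GreenModule (constZ G)}

/-- The component at `T` of the extension of a homomorphism `A → M(G/H)` to `Ξ_{G/H}(A)`. -/
noncomputable def extendApp (θ : A →+ M.mackey.val (orbit H)) (T : FinGSet G) :
    A ⊗[ℤ] equivMaps (permRep H) T →+ M.mackey.val T :=
  TensorProduct.liftAddHom
    ((AddMonoidHom.compHom (M.mackey.ind (pairing (orbit H) T))).comp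
      ((AddMonoidHom.compHom' (coeffMap H T).toAddMonoidHom).comp
        ((M.act (orbit H) ((orbit H).prod T)).comp θ)))
    fun r a φ => by rw [map_zsmul, map_zsmul, AddMonoidHom.zsmul_apply]

lemma extendApp_tmul (θ : A →+ M.mackey.val (orbit H)) (T : FinGSet G) (a : A)
    (φ : equivMaps (permRep H) T) :
    extendApp θ T (a ⊗ₜ φ) = M.mackey.ind (pairing (orbit H) T)
      (M.act (orbit H) ((orbit H).prod T) (θ a) (coeffMap H T φ)) := rfl

/-- On pure tensors, `pairing_naturality` moves `f` inside the pairing, naturality of the action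
moves it onto the coefficient function, and `coeffMap_natural` identifies the result. -/
lemma extendApp_natural (θ : A →+ M.mackey.val (orbit H)) {T U : FinGSet G}
    (f : (T : Burnside G) ⟶ U) (x : A ⊗[ℤ] equivMaps (permRep H) T) :
    extendApp θ U ((burnMap (permRep H) T U f).lTensor A x) =
      M.mackey.ind f (extendApp θ T x) := by
  induction x using TensorProduct.induction_on with
  | zero => simp only [map_zero]
  | add x y hx hy => simp only [map_add, hx, hy]
  | tmul a φ =>
    rw [LinearMap.lTensor_tmul, extendApp_tmul, extendApp_tmul, ← ind_comp, pairing_naturality,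
      ind_comp]
    refine congrArg (M.mackey.ind (pairing (orbit H) U)) (Eq.trans ?_
      (act_ind_right M (prodMap (𝟙 (orbit H : Burnside G)) f) (θ a) (coeffMap H T φ)))
    exact congrArg (M.act (orbit H) ((orbit H).prod U) (θ a)) (coeffMap_natural H f φ)

/-- Acting by `r` after the pairing is the product of the pairing with the identity of `T`;
`prodMap_pairing_id` turns this into the pairing for `S × T` up to re-bracketing, and associativity
of the action absorbs `r` into the coefficient function. -/
lemma extendApp_act (θ : A →+ M.mackey.val (orbit H)) (S T : FinGSet G)
    (x : A ⊗[ℤ] equivMaps (permRep H) S) (r : (constZ G).mackey.val T) :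
    extendApp θ (S.prod T) ((extMul (permRep H) S T r).lTensor A x) =
      M.act S T (extendApp θ S x) r := by
  induction x using TensorProduct.induction_on with
  | zero => simp only [map_zero, AddMonoidHom.zero_apply]
  | add x y hx hy => simp only [map_add, AddMonoidHom.add_apply, hx, hy]
  | tmul a φ =>
    rw [LinearMap.lTensor_tmul, extendApp_tmul, extendApp_tmul, act_ind_left, prodMap_pairing_id,
      ind_comp, ind_comp]
    refine congrArg (M.mackey.ind (pairing (orbit H) (S.prod T))) (Eq.trans ?_
      ((act_ind_right M (tr (assocMap (orbit H) S T)) (θ a) _).trans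
        (congrArg (M.mackey.ind _) (M.act_assoc _ _ _ (θ a) (coeffMap H S φ) r).symm)))
    exact congrArg (M.act (orbit H) ((orbit H).prod (S.prod T)) (θ a)) (coeffMap_extMul H S T φ r)

/-- The extension of a homomorphism `A → M(G/H)` to a morphism of `ℤ`-modules
`Ξ_{G/H}(A) ⟶ M`. -/
noncomputable def extend (θ : A →+ M.mackey.val (orbit H)) : (Xi H).obj A ⟶ M where
  hom := ObjectProperty.homMk
    { app := fun T => AddCommGrpCat.ofHom (extendApp θ T)
      naturality := fun _ _ f => AddCommGrpCat.hom_ext <| AddMonoidHom.ext fun x =>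
        extendApp_natural θ f x }
  map_act S T m r := extendApp_act θ S T m r

/-- The coefficient function of the generator comes from the unit, so acting by it is a map of the
Burnside category applied to `θ a`. By the triangle identity that map, followed by the pairing, is
the identity. -/
lemma extend_genMap (θ : A →+ M.mackey.val (orbit H)) (a : A) :
    Mackey.comp (extend θ).hom (orbit H) (a ⊗ₜ genMap H) = θ a := by
  change extendApp θ (orbit H) (a ⊗ₜ genMap H) = _
  rw [extendApp_tmul, coeffMap_genMap]
  refine (congrArg _ (act_ind_right M _ (θ a) (constZ G).one)).trans ?_
  rw [M.act_one, ← ind_comp, ← ind_comp, pairing_triangle, ind_id]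

/-- A morphism out of `Ξ_{G/H}(A)` is determined by its values on the elements `a ⊗ id`. -/
lemma Xi_hom_ext {α β : (Xi H).obj A ⟶ M}
    (h : ∀ a : A, Mackey.comp α.hom (orbit H) (a ⊗ₜ genMap H) =
      Mackey.comp β.hom (orbit H) (a ⊗ₜ genMap H)) : α = β := by
  refine GreenModule.Hom.ext (ObjectProperty.hom_ext _ (NatTrans.ext (funext fun T => ?_)))
  refine AddCommGrpCat.hom_ext (AddMonoidHom.ext fun x => ?_)
  change Mackey.comp α.hom T x = Mackey.comp β.hom T x
  -- Apply `γ` to the expansion of `φ` in terms of the generator; `γ` commutes with induced maps and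
  -- with the action.
  have key : ∀ (γ : (Xi H).obj A ⟶ M) (a : A) (φ : equivMaps (permRep H) T),
      Mackey.comp γ.hom T (a ⊗ₜ φ) = M.mackey.ind (pairing (orbit H) T)
        (M.act (orbit H) ((orbit H).prod T)
          (Mackey.comp γ.hom (orbit H) (a ⊗ₜ genMap H)) (coeffMap H T φ)) := fun γ a φ => by
    refine Eq.trans ?_ ((comp_ind γ.hom _ _).trans
      (congrArg (M.mackey.ind (pairing (orbit H) T)) (γ.map_act _ _ (a ⊗ₜ genMap H) _)))
    exact congrArg (fun ψ => Mackey.comp γ.hom T (a ⊗ₜ[ℤ] ψ)) (burnMap_pairing_genMap φ).symm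
  change A ⊗[ℤ] equivMaps (permRep H) T at x
  induction x using TensorProduct.induction_on with
  | zero => exact (map_zero _).trans (map_zero _).symm
  | add x y hx hy =>
    exact (map_add (Mackey.comp α.hom T) x y).trans
      ((congrArg₂ (· + ·) hx hy).trans (map_add (Mackey.comp β.hom T) x y).symm)
  | tmul a φ => rw [key, key, h]

end FreeModule
end MackeyTheory

namespace MackeyTheory

/-! ### Evaluation at the coset `K`: values, restrictions, transfers -/

section Evaluation

open FinGSet Burnside Classical

variable {G : Type u} [Group G] [Finite G]

section

variable {V : Type v} [AddCommGroup V] [Module ℤ V] (ρ : Representation ℤ G V)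

/-- Transitivity of `G/K` gives injectivity: `χ(γK) = γ χ(K)`. Conversely, for `v` fixed by `K` the
rule `γK ↦ γ v` is well defined and equivariant. -/
lemma evalCoset_bijective (K : Subgroup G) : Function.Bijective (evalCoset ρ K) := by
  constructor
  · intro φ ψ h
    refine Subtype.ext (funext fun x => ?_)
    induction x using QuotientGroup.induction_on with
    | H γ =>
      have key : ∀ χ : equivMaps ρ (orbit K), χ.1 (γ : G ⧸ K) = ρ γ (evalCoset ρ K χ).1 :=
        fun χ => (congrArg (fun c : G => χ.1 (c : G ⧸ K)) (mul_one γ).symm).trans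
          (χ.2 γ ((1 : G) : G ⧸ K))
      exact (key φ).trans ((congrArg (fun v => ρ γ v.1) h).trans (key ψ).symm)
  · intro v
    refine ⟨⟨fun x => Quotient.liftOn' x (fun γ => ρ γ v.1) fun a b hab => ?_, fun g x => ?_⟩, ?_⟩
    · have h := congrArg (ρ a) ((mem_fixedPts ρ).1 v.2 _ (QuotientGroup.leftRel_apply.1 hab))
      rw [← Module.End.mul_apply, ← map_mul, mul_inv_cancel_left] at h
      exact h.symm
    · induction x using QuotientGroup.induction_on with
      | H γ =>
        change ρ (g * γ) v.1 = ρ g (ρ γ v.1)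
        rw [map_mul]; rfl
    · refine Subtype.ext ?_
      change ρ 1 v.1 = v.1
      rw [map_one]; rfl

variable {ρ}

/-- Restriction along `G/K → G/L` is the inclusion of fixed points. -/
lemma evalCoset_res {K L : Subgroup G} (h : K ≤ L) (φ : equivMaps ρ (orbit L)) :
    evalCoset ρ K (burnMap ρ (orbit L) (orbit K) (res (orbitProj h)) φ) =
      fixedIncl ρ h (evalCoset ρ L φ) :=
  Subtype.ext (burnMap_res_apply ρ (orbitProj h) φ ((1 : G) : G ⧸ K))

/-- Restriction along a `G`-map `K ↦ gL` is translation by `g`. -/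
lemma coe_evalCoset_res {K L : Subgroup G} (f : orbit K →[G] orbit L) (g : G)
    (hf : f ((1 : G) : G ⧸ K) = (g : G ⧸ L)) (φ : equivMaps ρ (orbit L)) :
    (evalCoset ρ K (burnMap ρ (orbit L) (orbit K) (res f) φ) : V) =
      ρ g (evalCoset ρ L φ : V) := by
  refine (burnMap_res_apply ρ f φ ((1 : G) : G ⧸ K)).trans ?_
  exact (congrArg φ.1 (hf.trans (congrArg (fun c : G => (c : G ⧸ L)) (mul_one g).symm))).trans
    (φ.2 g ((1 : G) : G ⧸ L))

/-- Transfer along `G/K → G/L` is the sum over coset representatives. -/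
lemma evalCoset_tr {K L : Subgroup G} (h : K ≤ L) (φ : equivMaps ρ (orbit K)) :
    evalCoset ρ L (burnMap ρ (orbit K) (orbit L) (tr (orbitProj h)) φ) =
      cosetSum ρ K L (evalCoset ρ K φ) := by
  refine Subtype.ext ?_
  have : Fintype (L ⧸ K.subgroupOf L) := Fintype.ofFinite _
  have i : Fintype (G ⧸ K) := Fintype.ofFinite _
  have h2 : ((cosetSum ρ K L (evalCoset ρ K φ) : fixedPts ρ L) : V) =
      ∑ q : L ⧸ K.subgroupOf L, cosetSmul ρ L (evalCoset ρ K φ) q := sum_fintype_irrel _ _ _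
  rw [h2]
  change (burnMap ρ (orbit K) (orbit L) (tr (orbitProj h)) φ).1 ((1 : G) : G ⧸ L) = _
  rw [tr, burnMap_ofSpan, spanMap_apply]
  refine (sum_fintype_irrel _ i _).trans ?_
  refine (Finset.sum_congr rfl fun x _ => @if_congr _ _ _ (_) (_) _ _ _ _ Iff.rfl rfl rfl).trans
    ((Finset.sum_filter (fun x : G ⧸ K => orbitProj h x = ((1 : G) : G ⧸ L)) φ.1).symm.trans ?_)
  -- The fibre of `G/K → G/L` over the coset `L` is the image of `L/K` under the map induced by `L ⊆
  -- G`, and `φ(γK) = γ φ(K)` matches the summands.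
  refine (Finset.sum_bij (fun (q : L ⧸ K.subgroupOf L) _ => (Quotient.map' (s₂ :=
    QuotientGroup.leftRel K) (fun l : L => (l : G)) (fun a b hab => QuotientGroup.leftRel_apply.2
      (Subgroup.mem_subgroupOf.1 (QuotientGroup.leftRel_apply.1 hab))) q : G ⧸ K)) ?_ ?_ ?_ ?_).symm
  · intro q _
    refine Finset.mem_filter.2 ⟨Finset.mem_univ _, ?_⟩
    induction q using QuotientGroup.induction_on with
    | H γ => exact QuotientGroup.eq.2 (by simp)
  · intro q _ q' _ hq
    induction q using QuotientGroup.induction_on with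
    | H γ =>
      induction q' using QuotientGroup.induction_on with
      | H γ' => exact QuotientGroup.eq.2 (Subgroup.mem_subgroupOf.2 (QuotientGroup.eq.1 hq))
  · intro x hx
    replace hx := (Finset.mem_filter.1 hx).2
    induction x using QuotientGroup.induction_on with
    | H γ =>
      have hγ : γ ∈ L := by simpa using QuotientGroup.eq.1 hx
      exact ⟨((⟨γ, hγ⟩ : L) : L ⧸ K.subgroupOf L), Finset.mem_univ _, rfl⟩
  · intro q _
    induction q using QuotientGroup.induction_on with
    | H γ => exact ((congrArg (fun c : G => φ.1 (c : G ⧸ K)) (mul_one (γ : G)).symm).trans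
        (φ.2 (γ : G) ((1 : G) : G ⧸ K))).symm

end

/-- Evaluation is already an isomorphism before tensoring, so no flatness of `A` is involved. -/
lemma XiOrbit_bijective (H : Subgroup G) (A : AddCommGrpCat.{u}) (K : Subgroup G) :
    Function.Bijective (XiOrbit H A K) :=
  ((LinearEquiv.ofBijective _ (evalCoset_bijective (permRep H) K)).lTensor A).bijective

end Evaluation

/-! ### Yoneda's lemma for the coefficient system `A ⊗ F_{G/H}` -/

section CoefficientGenerators

variable {G : Type u} [Group G] {H : Subgroup G} {A : AddCommGrpCat.{u}}

/-- The generator `a ⊗ id` of `A ⊗ F_{G/H}`. -/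
noncomputable def coeffGen (H : Subgroup G) (a : A) :
    ((coeffFree H A).obj (Opposite.op ⟨H⟩)) :=
  a ⊗ₜ[ℤ] Finsupp.single (MulActionHom.id G) (1 : ℤ)

/-- A morphism out of `A ⊗ F_{G/H}` is determined by its values on the elements `a ⊗ id`. -/
lemma coeffFree_hom_ext {N : CoeffSystem G} {φ ψ : coeffFree H A ⟶ N}
    (h : ∀ a : A, (φ.app (Opposite.op ⟨H⟩)).hom (coeffGen H a) =
      (ψ.app (Opposite.op ⟨H⟩)).hom (coeffGen H a)) : φ = ψ := by
  refine NatTrans.ext (funext fun K => AddCommGrpCat.hom_ext (AddMonoidHom.ext fun x => ?_))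
  change A ⊗[ℤ] (((G ⧸ K.unop.stab) →[G] (G ⧸ H)) →₀ ℤ) at x
  let φ' : A ⊗[ℤ] (((G ⧸ K.unop.stab) →[G] (G ⧸ H)) →₀ ℤ) →+ N.obj K := (φ.app K).hom
  let ψ' : A ⊗[ℤ] (((G ⧸ K.unop.stab) →[G] (G ⧸ H)) →₀ ℤ) →+ N.obj K := (ψ.app K).hom
  change φ' x = ψ' x
  induction x using TensorProduct.induction_on with
  | zero => simp only [map_zero]
  | add x y hx hy => simp only [map_add, hx, hy]
  | tmul a c =>
    induction c using Finsupp.induction_linear with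
    | zero => simp only [TensorProduct.tmul_zero, map_zero]
    | add x y hx hy => simp only [TensorProduct.tmul_add, map_add, hx, hy]
    | single f n =>
      have hs : a ⊗ₜ[ℤ] Finsupp.single f n = n • a ⊗ₜ[ℤ] Finsupp.single f (1 : ℤ) := by
        rw [← TensorProduct.tmul_smul, Finsupp.smul_single, smul_eq_mul, mul_one]
      rw [hs, map_zsmul, map_zsmul]
      refine congrArg (n • ·) ?_
      -- Yoneda: `a ⊗ f` is the restriction along `f` of `a ⊗ id`, so naturality determines its
      -- image.
      let f' : (Opposite.op ⟨H⟩ : (OrbitCat G)ᵒᵖ) ⟶ K := Quiver.Hom.op (X := K.unop) (Y := ⟨H⟩) f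
      have hg : ((coeffFree H A).map f').hom (coeffGen H a) =
          (a ⊗ₜ[ℤ] Finsupp.single f (1 : ℤ) :
            A ⊗[ℤ] (((G ⧸ K.unop.stab) →[G] (G ⧸ H)) →₀ ℤ)) := by
        change a ⊗ₜ[ℤ] Finsupp.mapDomain _ (Finsupp.single _ _) = _
        rw [Finsupp.mapDomain_single]
        rfl
      have key : ∀ χ : coeffFree H A ⟶ N, (χ.app K).hom (a ⊗ₜ[ℤ] Finsupp.single f (1 : ℤ) :
            A ⊗[ℤ] (((G ⧸ K.unop.stab) →[G] (G ⧸ H)) →₀ ℤ)) =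
          (N.map f').hom ((χ.app (Opposite.op ⟨H⟩)).hom (coeffGen H a)) := fun χ =>
        (congrArg (χ.app K).hom hg.symm).trans
          (congrArg (fun l => l.hom (coeffGen H a)) (χ.naturality f'))
      exact (key φ).trans ((congrArg (N.map f').hom (h a)).trans (key ψ).symm)

end CoefficientGenerators

/-! ### The adjunction and the universal property -/

section Universal

open FinGSet Burnside

variable {G : Type u} [Group G] [Finite G] {H : Subgroup G} {A : AddCommGrpCat.{u}}
  {M : GreenModule (constZ G)}

/-- The generators of the coefficient system and of the module correspond, which reduces both the
universal property and the formula for the unit to statements about `genMap`. -/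
lemma XiUnit_coeffGen (a : A) :
    ((XiUnit H A).app (Opposite.op ⟨H⟩)).hom (coeffGen H a) = a ⊗ₜ[ℤ] genMap H := by
  change linearize H A H (a ⊗ₜ[ℤ] Finsupp.single (MulActionHom.id G) (1 : ℤ)) = _
  refine (LinearMap.lTensor_tmul A _ a _).trans (congrArg (a ⊗ₜ[ℤ] ·) ?_)
  exact (Finsupp.linearCombination_single ℤ _ _).trans (one_smul ℤ _)

variable (H A) in
/-- The inclusion `a ↦ a ⊗ id` of `A` into `Ξ_{G/H}(A)(G/H)`. -/
noncomputable def genHom : A →+ ((Xi H).obj A).mackey.val (orbit H) :=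
  ((TensorProduct.mk ℤ A (equivMaps (permRep H) (orbit H))).flip (genMap H)).toAddMonoidHom

/-- Morphisms of `ℤ`-modules `Ξ_{G/H}(A) ⟶ M` are homomorphisms `A → M(G/H)`. -/
noncomputable def XiHomEquiv (H : Subgroup G) (A : AddCommGrpCat.{u})
    (M : GreenModule (constZ G)) :
    ((Xi H).obj A ⟶ M) ≃ (A ⟶ (GreenModule.evaluation (constZ G) (orbit H)).obj M) where
  toFun α := AddCommGrpCat.ofHom ((Mackey.comp α.hom (orbit H)).comp (genHom H A))
  invFun θ := extend θ.hom
  left_inv _ := Xi_hom_ext fun a => extend_genMap _ a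
  right_inv _ := AddCommGrpCat.hom_ext (AddMonoidHom.ext fun a => extend_genMap _ a)

/-- The adjunction between `Ξ_{G/H}` and evaluation at `G/H`. -/
noncomputable def XiAdjunction (H : Subgroup G) :
    Xi H ⊣ GreenModule.evaluation (constZ G) (orbit H) :=
  Adjunction.mkOfHomEquiv
    { homEquiv := XiHomEquiv H
      homEquiv_naturality_left_symm := fun f θ => Xi_hom_ext fun a =>
        (extend_genMap _ a).trans (extend_genMap θ.hom (f.hom a)).symm
      homEquiv_naturality_right := fun _ _ => rfl }

lemma XiAdjunction_unit (a : A) :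
    ((XiAdjunction H).unit.app A).hom a =
      ((XiUnit H A).app (Opposite.op ⟨H⟩)).hom (coeffGen H a) := by
  rw [XiUnit_coeffGen, XiAdjunction, Adjunction.mkOfHomEquiv_unit_app]
  rfl

/-- The universal property of `Ξ_{G/H}(A)` among `ℤ`-modules with a morphism from `A ⊗ F_{G/H}`. -/
lemma existsUnique_XiUnit_comp (φ : coeffFree H A ⟶ toCoeff.obj M.mackey) :
    ∃! ψ : (Xi H).obj A ⟶ M, XiUnit H A ≫ toCoeff.map ψ.hom = φ := by
  have key : ∀ (ψ : (Xi H).obj A ⟶ M) (a : A),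
      ((XiUnit H A ≫ toCoeff.map ψ.hom).app (Opposite.op ⟨H⟩)).hom (coeffGen H a) =
        Mackey.comp ψ.hom (orbit H) (a ⊗ₜ genMap H) := fun ψ a =>
    congrArg (Mackey.comp ψ.hom (orbit H)) (XiUnit_coeffGen a)
  -- `θ a` is the value of `φ` on `a ⊗ id`, the only data of `φ` that matters by
  -- `coeffFree_hom_ext`.
  let θ : A →+ M.mackey.val (orbit H) := (φ.app (Opposite.op ⟨H⟩)).hom.comp
    ((TensorProduct.mk ℤ A (((G ⧸ H) →[G] (G ⧸ H)) →₀ ℤ)).flip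
      (Finsupp.single (MulActionHom.id G) 1)).toAddMonoidHom
  refine ⟨extend θ, coeffFree_hom_ext fun a => (key _ a).trans (extend_genMap θ a), ?_⟩
  rintro ψ rfl
  exact Xi_hom_ext fun a => (key ψ a).symm.trans (extend_genMap θ a).symm

end Universal
end MackeyTheory

open MackeyTheory MackeyTheory.FinGSet MackeyTheory.Burnside
theorem mainTheorem4 {G : Type u} [Group G] [Finite G] (H : Subgroup G) :
    -- the values `Ξ_{G/H}(A)(G/K) = A ⊗ (ℤ(G/H))^K`, naturally in `A`
    (∀ (A : AddCommGrpCat.{u}) (K : Subgroup G), Function.Bijective (XiOrbit H A K)) ∧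
    (∀ (A A' : AddCommGrpCat.{u}) (f : A ⟶ A') (K : Subgroup G)
      (x : ((Xi H).obj A).mackey.val (orbit K)),
      XiOrbit H A' K (Mackey.comp ((Xi H).map f).hom (orbit K) x) =
        f.hom.toIntLinearMap.rTensor (fixedPts (permRep H) K) (XiOrbit H A K x)) ∧
    -- restrictions are the inclusions of fixed points
    (∀ (A : AddCommGrpCat.{u}) (K L : Subgroup G) (h : K ≤ L)
      (x : ((Xi H).obj A).mackey.val (orbit L)),
      XiOrbit H A K (((Xi H).obj A).mackey.ind (res (orbitProj h)) x) =
        (fixedIncl (permRep H) h).lTensor A (XiOrbit H A L x)) ∧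
    -- transfers are the sums over coset representatives
    (∀ (A : AddCommGrpCat.{u}) (K L : Subgroup G) (h : K ≤ L)
      (x : ((Xi H).obj A).mackey.val (orbit K)),
      XiOrbit H A L (((Xi H).obj A).mackey.ind (tr (orbitProj h)) x) =
        (cosetSum (permRep H) K L).lTensor A (XiOrbit H A K x)) ∧
    -- restriction along a general map of orbits `K ↦ gL` is translation by `g`
    (∀ (A : AddCommGrpCat.{u}) (K L : Subgroup G) (f : orbit K →[G] orbit L) (g : G)
      (_ : f ((1 : G) : G ⧸ K) = (g : G ⧸ L)) (x : ((Xi H).obj A).mackey.val (orbit L)),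
      (fixedPts (permRep H) K).subtype.lTensor A
          (XiOrbit H A K (((Xi H).obj A).mackey.ind (res f) x)) =
        (permRep H g).lTensor A
          ((fixedPts (permRep H) L).subtype.lTensor A (XiOrbit H A L x))) ∧
    -- `Ξ_{G/H}(A)` is the universal `ℤ`-module on the coefficient system `A ⊗ F_{G/H}`
    (∀ (A : AddCommGrpCat.{u}) (M : GreenModule (constZ G))
      (φ : coeffFree H A ⟶ toCoeff.obj M.mackey),
      ∃! ψ : (Xi H).obj A ⟶ M, XiUnit H A ≫ toCoeff.map ψ.hom = φ) ∧
    -- `Ξ_{G/H}` is left adjoint to evaluation at `G/H`, with unit `a ↦ a ⊗ id`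
    (∃ adj : Xi H ⊣ GreenModule.evaluation (constZ G) (orbit H),
      ∀ (A : AddCommGrpCat.{u}) (a : A),
        (adj.unit.app A).hom a =
          ((XiUnit H A).app (Opposite.op ⟨H⟩)).hom
            (a ⊗ₜ[ℤ] Finsupp.single (MulActionHom.id G) (1 : ℤ))) := by
  refine ⟨fun A K => XiOrbit_bijective H A K, fun A A' f K x => ?_, fun A K L h x => ?_,
    fun A K L h x => ?_, fun A K L f g hf x => ?_, fun A M φ => existsUnique_XiUnit_comp φ,
    XiAdjunction H, fun A a => XiAdjunction_unit a⟩
  · exact (rTensor_lTensor_apply f.hom.toIntLinearMap (evalCoset (permRep H) K) x).symm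
  · refine (LinearMap.lTensor_comp_apply A _ _ x).symm.trans
      (Eq.trans ?_ (LinearMap.lTensor_comp_apply A _ _ x))
    exact congrArg (fun l => LinearMap.lTensor A l x) (LinearMap.ext fun φ => evalCoset_res h φ)
  · refine (LinearMap.lTensor_comp_apply A _ _ x).symm.trans
      (Eq.trans ?_ (LinearMap.lTensor_comp_apply A _ _ x))
    exact congrArg (fun l => LinearMap.lTensor A l x) (LinearMap.ext fun φ => evalCoset_tr h φ)
  -- Translation by `g` does not preserve the fixed points of `L`, so both sides are compared in `A
  -- ⊗ ℤ(G/H)`. Nothing is lost, as the fixed points are a direct summand of `ℤ(G/H)`. The two sides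
  -- are packaged as additive maps on an explicit tensor product, where it suffices to check pure
  -- tensors.
  · let l : A ⊗[ℤ] equivMaps (permRep H) (orbit L) →+ A ⊗[ℤ] MonoidAlgebra ℤ (G ⧸ H) :=
      ((fixedPts (permRep H) K).subtype.lTensor A).toAddMonoidHom.comp
        ((XiOrbit H A K).comp (((Xi H).obj A).mackey.ind (res f)))
    let l' : A ⊗[ℤ] equivMaps (permRep H) (orbit L) →+ A ⊗[ℤ] MonoidAlgebra ℤ (G ⧸ H) :=
      ((permRep H g).lTensor A).toAddMonoidHom.comp
        (((fixedPts (permRep H) L).subtype.lTensor A).toAddMonoidHom.comp (XiOrbit H A L))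
    change A ⊗[ℤ] equivMaps (permRep H) (orbit L) at x
    change l x = l' x
    induction x using TensorProduct.induction_on with
    | zero => simp only [map_zero]
    | add x y hx hy => simp only [map_add, hx, hy]
    | tmul a φ => exact congrArg (a ⊗ₜ[ℤ] ·) (coe_evalCoset_res f g hf φ)
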